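/- Let $1<p<\infty$ and $p^{-1}+q^{-1}=1$, and let $\mathbb T$ be the unit circle with Lebesgue measure. For $1<r<\infty$ let $H^r(\mathbb T)=\{f\in L^r(\mathbb T): f_n=0 \text{ for all } n<0\}$, where $f_n$ are the Fourier coefficients of $f$, let $\overline{H^r(\mathbb T)}=\{f:\bar f\in H^r(\mathbb T)\}$, and let $L^r_{\rm even}(\mathbb T)$ be the set of $f\in L^r(\mathbb T)$ with $f(t^{-1})=f(t)$ almost everywhere. Let $P:\sum_{n\in\mathbb Z}f_nt^n\mapsto\sum_{n\ge0}f_nt^n$ be the Riesz projection, which is bounded from $L^r(\mathbb T)$ onto $H^r(\mathbb T)$, let $(Jf)(t)=t^{-1}f(t^{-1})$, and let $L^p_J(\mathbb T)$ be the image of $\frac12(I+J)$ on $L^p(\mathbb T)$. For $\phi\in L^\infty(\mathbb T)$ let $M(\phi)=T(\phi)+H(\phi)$ on $H^p(\mathbb T)$, where $T(\phi)f=P(\phi f)$ and $H(\phi)f=P(\phi\,(Jf))$. A function $\phi$ invertible in $L^\infty(\mathbb T)$ is said to admit an asymmetric factorization in $L^p(\mathbb T)$ with index $\kappa\in\mathbb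 Z$ if there are functions $\phi_-,\phi_0$ on $\mathbb T$ with $\phi(t)=\phi_-(t)\,t^{\kappa}\,\phi_0(t)$ for almost every $t\in\mathbb T$ such that (i) $(1+t^{-1})\phi_-\in\overline{H^p(\mathbb T)}$ and $(1-t^{-1})\phi_-^{-1}\in\overline{H^q(\mathbb T)}$; (ii) $|1-t|\phi_0\in L^q_{\rm even}(\mathbb T)$ and $|1+t|\phi_0^{-1}\in L^p_{\rm even}(\mathbb T)$; (iii) the linear operator $Bf=\phi_0^{-1}(I+J)P(\phi_-^{-1}f)$, defined for $f\in X_1=\{(1-t^{-1})r(t): r \text{ a trigonometric polynomial}\}$, extends to a bounded linear operator from $L^p(\mathbb T)$ into $L^p_J(\mathbb T)$. **Theorem.** Let $\phi$ be invertible in $L^\infty(\mathbb T)$. Then $M(\phi)$ is a Fredholm operator on $H^p(\mathbb T)$ if and only if $\phi$ admits an asymmetric factorization in $L^p(\mathbb T)$ with some index $\kappa\in\mathbb Z$. In this case, for the index $\kappa$ of any such factorization, $\dim\ker M(\phi)=\max\{0,-\kappa\}$ and $\dim\ker M(\phi)^*=\max\{0,\kappa\}$, where $M(\phi)^*$ is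 the adjoint of $M(\phi)$ on the dual space of $H^p(\mathbb T)$. -/

import Mathlib

open MeasureTheory AddCircle
open scoped ENNReal ComplexConjugate

noncomputable section

namespace ToeplitzHankel

/-- The unit circle `𝕋`, parametrised as `t = exp (2 π i x)` with `x ∈ ℝ / ℤ`. In this
parametrisation `fourier n x = t ^ n`, and `x ↦ -x` is `t ↦ t⁻¹`. -/
abbrev 𝕋 : Type := UnitAddCircle

/-- Normalised Lebesgue measure on the circle. -/
abbrev μ𝕋 : Measure 𝕋 := haarAddCircle

/-- The Lebesgue space `L^p(𝕋)`. -/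
abbrev LpT (p : ℝ≥0∞) : Type := Lp ℂ p μ𝕋

/-- `f` is a function in the Hardy space `H^p(𝕋)`. -/
def MemHardy (p : ℝ≥0∞) (f : 𝕋 → ℂ) : Prop :=
  MemLp f p μ𝕋 ∧ ∀ n : ℤ, n < 0 → fourierCoeff f n = 0

/-- `f` is a function in the complex conjugate Hardy space, that is, `conj f ∈ H^p(𝕋)`. -/
def MemConjHardy (p : ℝ≥0∞) (f : 𝕋 → ℂ) : Prop :=
  MemHardy p (fun x => conj (f x))

/-- `f` belongs to `L^p_even(𝕋)`: it is in `L^p(𝕋)` and `f(t⁻¹) = f(t)` almost everywhere. -/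
def MemLpEven (p : ℝ≥0∞) (f : 𝕋 → ℂ) : Prop :=
  MemLp f p μ𝕋 ∧ ∀ᵐ x ∂μ𝕋, f (-x) = f x

theorem integrable_fourier_smul (p : ℝ≥0∞) [hp : Fact (1 ≤ p)] (f : LpT p) (n : ℤ) :
    Integrable (fun x => fourier n x • f x) μ𝕋 := by
  have hf : Integrable f μ𝕋 := (Lp.memLp f).integrable hp.out
  have hc : Continuous (fun x : 𝕋 => (fourier n x : ℂ)) := (fourier n).continuous
  exact hf.bdd_mul (c := 1) hc.aestronglyMeasurable
    (Filter.Eventually.of_forall fun x => by rw [fourier_apply, Circle.norm_coe])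

theorem fourierCoeff_add_Lp (p : ℝ≥0∞) [Fact (1 ≤ p)] (f g : LpT p) (n : ℤ) :
    fourierCoeff (⇑(f + g)) n = fourierCoeff f n + fourierCoeff g n := by
  unfold fourierCoeff
  rw [← integral_add (integrable_fourier_smul p f _) (integrable_fourier_smul p g _)]
  refine integral_congr_ae ?_
  filter_upwards [Lp.coeFn_add f g] with x hx
  rw [hx, Pi.add_apply, smul_add]

theorem fourierCoeff_smul_Lp (p : ℝ≥0∞) (c : ℂ) (f : LpT p) (n : ℤ) :
    fourierCoeff (⇑(c • f)) n = c * fourierCoeff f n := by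
  unfold fourierCoeff
  rw [← integral_const_mul]
  refine integral_congr_ae ?_
  filter_upwards [Lp.coeFn_smul c f] with x hx
  simp only [hx, Pi.smul_apply, smul_eq_mul]
  ring

theorem fourierCoeff_zero_Lp (p : ℝ≥0∞) (n : ℤ) :
    fourierCoeff (⇑(0 : LpT p)) n = 0 := by
  have h := fourierCoeff_smul_Lp p 0 (0 : LpT p) n
  simpa using h

/-- The Hardy space `H^p(𝕋)` as a subspace of `L^p(𝕋)`. -/
def Hp (p : ℝ≥0∞) [Fact (1 ≤ p)] : Submodule ℂ (LpT p) where
  carrier := {f | ∀ n : ℤ, n < 0 → fourierCoeff f n = 0}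
  add_mem' := by
    intro f g hf hg n hn
    rw [fourierCoeff_add_Lp, hf n hn, hg n hn, add_zero]
  zero_mem' := fun n _ => fourierCoeff_zero_Lp p n
  smul_mem' := by
    intro c f hf n hn
    rw [fourierCoeff_smul_Lp, hf n hn, mul_zero]

open Classical in
/-- The Riesz projection `P : ∑_{n ∈ ℤ} f_n t^n ↦ ∑_{n ≥ 0} f_n t^n`, as an operator from `L^p(𝕋)`
to `H^p(𝕋)`: the bounded linear operator determined by this action on Fourier coefficients. For
`1 < p < ∞` it exists by the theorem of M. Riesz, and the value `0` is never used. -/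
def rieszProjection (p : ℝ≥0∞) [Fact (1 ≤ p)] : LpT p →L[ℂ] Hp p :=
  if h : ∃ P : LpT p →L[ℂ] Hp p, ∀ (f : LpT p) (n : ℤ),
      fourierCoeff (⇑(P f : LpT p)) n = if 0 ≤ n then fourierCoeff f n else 0
  then h.choose else 0

/-- The multiplication operator `L(φ) f = φ f` on `L^p(𝕋)`, for `φ ∈ L^∞(𝕋)`. -/
def mulOp (p : ℝ≥0∞) [Fact (1 ≤ p)] (φ : LpT ∞) : LpT p →L[ℂ] LpT p :=
  (ContinuousLinearMap.mul ℂ ℂ).holderL μ𝕋 ∞ p p φ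

/-- The flip operator `(J f)(t) = t⁻¹ f(t⁻¹)` on `L^p(𝕋)`. -/
def flipOp (p : ℝ≥0∞) [Fact (1 ≤ p)] : LpT p →L[ℂ] LpT p :=
  mulOp p (fourierLp ∞ (-1)) ∘L
    (Lp.compMeasurePreservingₗᵢ ℂ (fun x : 𝕋 => -x)
      (Measure.measurePreserving_neg μ𝕋)).toContinuousLinearMap

/-- The Toeplitz operator `T(φ) f = P(φ f)` on `H^p(𝕋)`. -/
def toeplitz (p : ℝ≥0∞) [Fact (1 ≤ p)] (φ : LpT ∞) : Hp p →L[ℂ] Hp p :=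
  rieszProjection p ∘L mulOp p φ ∘L (Hp p).subtypeL

/-- The Hankel operator `H(φ) f = P(φ (J f))` on `H^p(𝕋)`. -/
def hankel (p : ℝ≥0∞) [Fact (1 ≤ p)] (φ : LpT ∞) : Hp p →L[ℂ] Hp p :=
  rieszProjection p ∘L mulOp p φ ∘L flipOp p ∘L (Hp p).subtypeL

/-- The Toeplitz + Hankel operator `M(φ) = T(φ) + H(φ)` on `H^p(𝕋)`. -/
def toeplitzHankel (p : ℝ≥0∞) [Fact (1 ≤ p)] (φ : LpT ∞) : Hp p →L[ℂ] Hp p :=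
  toeplitz p φ + hankel p φ

/-- The Banach space adjoint `A^* : ℓ ↦ ℓ ∘ A` on the dual space. -/
def banachAdjoint {E : Type*} [NormedAddCommGroup E] [NormedSpace ℂ E] (A : E →L[ℂ] E) :
    StrongDual ℂ E →L[ℂ] StrongDual ℂ E :=
  (ContinuousLinearMap.compL ℂ E E ℂ).flip A

/-- `φ ∈ G L^∞(𝕋)`: `φ` is invertible in the Banach algebra `L^∞(𝕋)`. -/
def IsInvertibleLinfty (φ : LpT ∞) : Prop :=
  ∃ ψ : LpT ∞, ∀ᵐ x ∂μ𝕋, φ x * ψ x = 1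

/-- The space `L^p_J(𝕋)`, the image of the projection `P_J = (I + J) / 2` on `L^p(𝕋)`. -/
def LpJ (p : ℝ≥0∞) [Fact (1 ≤ p)] : Submodule ℂ (LpT p) :=
  ((2⁻¹ : ℂ) • (ContinuousLinearMap.id ℂ (LpT p) + flipOp p)).range

/-- The space of trigonometric polynomials. -/
def trigPoly : Submodule ℂ C(𝕋, ℂ) := Submodule.span ℂ (Set.range fourier)

/-- The space `X₁ = {(1 - t⁻¹) r(t) : r a trigonometric polynomial}`. -/
def X₁ : Set C(𝕋, ℂ) := {f | ∃ r ∈ trigPoly, f = (1 - fourier (-1)) * r}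

/-- The function `B f = φ_0⁻¹ (I + J) P (φ_-⁻¹ f)`, where `φ_-⁻¹ f ∈ L^q(𝕋)`. -/
def opB (q : ℝ≥0∞) [Fact (1 ≤ q)] (φm φ0 : 𝕋 → ℂ) (f : C(𝕋, ℂ))
    (hf : MemLp (fun x => (φm x)⁻¹ * f x) q μ𝕋) : 𝕋 → ℂ :=
  let u : LpT q := rieszProjection q hf.toLp
  fun x => (φ0 x)⁻¹ * (u + flipOp q u : LpT q) x

/-- `φ = φ_- t^κ φ_0` is an asymmetric factorization of `φ` in `L^p(𝕋)`, where `1/p + 1/q = 1`. -/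
structure IsAsymmetricFactorization (p q : ℝ≥0∞) [Fact (1 ≤ p)] [Fact (1 ≤ q)]
    (φ : LpT ∞) (φm : 𝕋 → ℂ) (κ : ℤ) (φ0 : 𝕋 → ℂ) : Prop where
  factorization : ∀ᵐ x ∂μ𝕋, φ x = φm x * fourier κ x * φ0 x
  minus_mem : MemConjHardy p (fun x => (1 + fourier (-1) x) * φm x)
  minus_inv_mem : MemConjHardy q (fun x => (1 - fourier (-1) x) * (φm x)⁻¹)
  even_mem : MemLpEven q (fun x => (‖1 - (fourier 1 x : ℂ)‖ : ℂ) * φ0 x)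
  even_inv_mem : MemLpEven p (fun x => (‖1 + (fourier 1 x : ℂ)‖ : ℂ) * (φ0 x)⁻¹)
  /-- The operator `B`, defined on `X₁`, extends to a bounded operator from `L^p` to `L^p_J`. -/
  bounded_extension : ∃ Bext : LpT p →L[ℂ] LpJ p, ∀ f ∈ X₁,
    ∃ hf : MemLp (fun x => (φm x)⁻¹ * f x) q μ𝕋,
      (Bext (ContinuousMap.toLp p μ𝕋 ℂ f) : LpT p) =ᵐ[μ𝕋] opB q φm φ0 f hf

end ToeplitzHankel

end

/-!
Write `M(ψ) f = P (ψ (f + J f))` for a symbol `ψ`, and put `A_n = M(t^{-n} φ)`. On Fourier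
coefficients `A_{n+1} = L A_n`, where `L` is the backward shift on `H^p`, a surjection with
one-dimensional kernel. The theorem is the conjunction of three facts.

* `M(ψ)` is bijective if and only if `ψ` has a factorization with index `0`
  (`bijective_of_factorization`, `exists_factorization_of_bijective`). Since a factorization of `φ`
  with index `κ` is one of `t^{-κ} φ` with index `0`, factorizations of `φ` with index `κ` exist
  exactly when `A_κ` is bijective.
* If `A_κ` is bijective, then `A_0` is Fredholm and the dimensions of `ker A_0` and `ker A_0^*` can
  be read off from `A_0 = L^{-κ} A_κ` or `A_κ = L^κ A_0`
  (`chain_ker_of_nonpos`, `chain_ker_of_nonneg`).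
* If `A_0` is Fredholm, some `A_κ` is bijective (`exists_bijective_of_isFredholm`). Beyond linear
  algebra this needs `⋂ ker A_n = 0` and an analogue of Coburn's lemma: the kernel and the cokernel
  of `A_n` are not both nonzero (`coburn`).

The arguments on the circle share one mechanism. A product of a function in `L^p` and one in `L^q`,
both with spectrum bounded above, has spectrum bounded above, and the leading coefficients multiply
(`fourierCoeff_mul_of_specLE`). If such a product `k` also satisfies `k(t⁻¹) = -t^m k(t)`, its
coefficients are antisymmetric about `-m/2`, so that all but finitely many vanish
(`fourierCoeff_of_antisymm`). For `m = 2` and negative spectrum this gives `k = 0`; for `m = 2`,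
spectrum in the nonpositive frequencies and leading coefficient `1` it gives `k = 1 - t⁻²`, from
which the factors are obtained; for `m = 0` it gives the analogue of Coburn's lemma.

Two analytic facts are proved on the way: functionals on `L^p` of a finite measure are represented
by functions in `L^q` (`exists_pairing_eq`), and the Riesz projection is bounded on `L^p`
(`exists_riesz`). For `1 < p ≤ 2` the latter follows from the mean value property of `F^p` for
polynomials `F` with positive real part, and for `p > 2` by duality.
-/

noncomputable section

namespace ToeplitzHankel

/-! ### Fourier coefficients on the circle -/

theorem memLp_fourier_mul {p : ℝ≥0∞} {f : 𝕋 → ℂ} (hf : MemLp f p μ𝕋) (k : ℤ) :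
    MemLp (fun x => fourier k x * f x) p μ𝕋 := by
  refine hf.of_le_mul (c := 1) ((fourier k).continuous.aestronglyMeasurable.mul hf.1)
    (Filter.Eventually.of_forall fun x => ?_)
  rw [norm_mul, fourier_apply, Circle.norm_coe]

theorem integrable_fourier_mul {f : 𝕋 → ℂ} (hf : Integrable f μ𝕋) (k : ℤ) :
    Integrable (fun x => fourier k x * f x) μ𝕋 :=
  hf.fourier_smul k

theorem fourier_mul_fourier (m n : ℤ) (x : 𝕋) :
    (fourier m x : ℂ) * fourier n x = fourier (m + n) x := fourier_add.symm

theorem fourier_neg_mul_fourier (n : ℤ) (x : 𝕋) : (fourier (-n) x : ℂ) * fourier n x = 1 := by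
  rw [fourier_mul_fourier, neg_add_cancel, fourier_zero]

theorem fourier_apply_neg (n : ℤ) (x : 𝕋) : (fourier n (-x) : ℂ) = fourier (-n) x := by
  rw [fourier_apply, fourier_apply, smul_neg, neg_smul]

theorem fourierCoeff_fourier_mul (f : 𝕋 → ℂ) (k n : ℤ) :
    fourierCoeff (fun x => fourier k x * f x) n = fourierCoeff f (n - k) := by
  unfold fourierCoeff
  refine integral_congr_ae (Filter.Eventually.of_forall fun x => ?_)
  simp only [smul_eq_mul]
  rw [← mul_assoc, fourier_mul_fourier]
  congr 3
  ring

theorem fourierCoeff_comp_neg (f : 𝕋 → ℂ) (n : ℤ) :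
    fourierCoeff (fun x => f (-x)) n = fourierCoeff f (-n) := by
  unfold fourierCoeff
  rw [← (Measure.measurePreserving_neg μ𝕋).integral_comp
    (MeasurableEquiv.neg 𝕋).measurableEmbedding]
  refine integral_congr_ae (Filter.Eventually.of_forall fun x => ?_)
  simp only [smul_eq_mul, fourier_apply_neg, neg_neg]

theorem fourierCoeff_conj (f : 𝕋 → ℂ) (n : ℤ) :
    fourierCoeff (fun x => conj (f x)) n = conj (fourierCoeff f (-n)) := by
  unfold fourierCoeff
  rw [← integral_conj]
  refine integral_congr_ae (Filter.Eventually.of_forall fun x => ?_)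
  simp only [smul_eq_mul, map_mul, neg_neg]
  rw [fourier_neg]

theorem fourierCoeff_add' {f g : 𝕋 → ℂ} (hf : Integrable f μ𝕋) (hg : Integrable g μ𝕋) (n : ℤ) :
    fourierCoeff (fun x => f x + g x) n = fourierCoeff f n + fourierCoeff g n :=
  congrFun (fourierCoeff.add hf hg) n

theorem fourierCoeff_sub' {f g : 𝕋 → ℂ} (hf : Integrable f μ𝕋) (hg : Integrable g μ𝕋) (n : ℤ) :
    fourierCoeff (fun x => f x - g x) n = fourierCoeff f n - fourierCoeff g n := by
  have h := fourierCoeff_add' hf (hg.const_mul (-1)) n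
  rw [fourierCoeff.const_mul] at h
  calc _ = fourierCoeff (fun x => f x + -1 * g x) n := by congr 1; ext x; ring
    _ = _ := by rw [h]; ring

theorem fourierCoeff_fourier_apply (k n : ℤ) :
    fourierCoeff (fun x : 𝕋 => (fourier k x : ℂ)) n = if n = k then 1 else 0 := by
  have h := congrFun (fourierCoeff_fourier (T := 1) k) n
  rw [Pi.single_apply] at h
  exact h

theorem fourierCoeff_congr {f g : 𝕋 → ℂ} (h : f =ᵐ[μ𝕋] g) (n : ℤ) :
    fourierCoeff f n = fourierCoeff g n := congrFun (fourierCoeff_congr_ae h) n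

/-- An integrable function all of whose Fourier coefficients vanish integrates to zero against
every continuous function, because trigonometric polynomials are uniformly dense. -/
theorem integral_continuous_mul_eq_zero {f : 𝕋 → ℂ} (hf : Integrable f μ𝕋)
    (h : ∀ n, fourierCoeff f n = 0) (g : C(𝕋, ℂ)) : ∫ x, g x * f x ∂μ𝕋 = 0 := by
  have hint : ∀ g : C(𝕋, ℂ), Integrable (fun x => g x * f x) μ𝕋 := fun g =>
    hf.bdd_mul (c := ‖g‖) g.continuous.aestronglyMeasurable
      (Filter.Eventually.of_forall fun x => g.norm_coe_le_norm x)
  let Φ : C(𝕋, ℂ) →L[ℂ] ℂ := LinearMap.mkContinuous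
    { toFun := fun g => ∫ x, g x * f x ∂μ𝕋
      map_add' := fun a b => by
        rw [← integral_add (hint a) (hint b)]
        simp only [ContinuousMap.add_apply, add_mul]
      map_smul' := fun c a => by
        rw [RingHom.id_apply, smul_eq_mul, ← integral_const_mul]
        simp only [ContinuousMap.smul_apply, smul_eq_mul, mul_assoc] }
    (∫ x, ‖f x‖ ∂μ𝕋) (fun g => by
      refine (norm_integral_le_integral_norm _).trans ?_
      rw [mul_comm, ← integral_const_mul]
      refine integral_mono (hint g).norm (hf.norm.const_mul _) fun x => ?_
      simp only [norm_mul]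
      gcongr
      exact g.norm_coe_le_norm x)
  have hΦ : Φ = 0 := by
    refine ContinuousLinearMap.ext_on (s := Set.range (fourier (T := 1))) ?_ ?_
    · rw [dense_iff_closure_eq, ← Submodule.topologicalClosure_coe, span_fourier_closure_eq_top]
      rfl
    · rintro _ ⟨n, rfl⟩
      have := h (-n)
      rw [fourierCoeff, neg_neg] at this
      exact this
  exact congrArg (fun T : C(𝕋, ℂ) →L[ℂ] ℂ => T g) hΦ

/-- Uniqueness of Fourier coefficients in `L^1`. -/
theorem ae_eq_zero_of_fourierCoeff_eq_zero {f : 𝕋 → ℂ} (hf : Integrable f μ𝕋)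
    (h : ∀ n, fourierCoeff f n = 0) : f =ᵐ[μ𝕋] 0 := by
  refine ae_eq_zero_of_forall_setIntegral_isClosed_eq_zero hf fun s hs => ?_
  -- The indicator of a closed set is a bounded pointwise limit of continuous functions.
  have hδ : ∀ n : ℕ, (0 : ℝ) < 1 / ((n : ℝ) + 1) := fun n => by positivity
  let u : ℕ → C(𝕋, ℂ) := fun n =>
    ⟨fun x => ((thickenedIndicator (hδ n) s x : NNReal) : ℂ), by fun_prop⟩
  have hlim := thickenedIndicator_tendsto_indicator_closure hδ
    tendsto_one_div_add_atTop_nhds_zero_nat s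
  rw [hs.closure_eq, tendsto_pi_nhds] at hlim
  have hub : ∀ n x, ‖u n x‖ ≤ 1 := fun n x => by
    have := thickenedIndicator_le_one (hδ n) s x
    simp only [u, ContinuousMap.coe_mk]
    rw [Complex.norm_real, Real.norm_of_nonneg (NNReal.coe_nonneg _)]
    exact_mod_cast this
  have key : Filter.Tendsto (fun n => ∫ x, u n x * f x ∂μ𝕋) Filter.atTop
      (nhds (∫ x, s.indicator f x ∂μ𝕋)) := by
    refine tendsto_integral_of_dominated_convergence (fun x => ‖f x‖)
      (fun n => (u n).continuous.aestronglyMeasurable.mul hf.1) hf.norm (fun n => ?_) ?_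
    · refine Filter.Eventually.of_forall fun x => ?_
      rw [norm_mul]
      exact mul_le_of_le_one_left (norm_nonneg _) (hub n x)
    · refine Filter.Eventually.of_forall fun x => ?_
      have h1 : Filter.Tendsto (fun n => u n x) Filter.atTop
          (nhds (((s.indicator (fun _ => (1 : NNReal)) x : NNReal) : ℝ) : ℂ)) :=
        (Complex.continuous_ofReal.tendsto _).comp
          ((NNReal.continuous_coe.tendsto _).comp (hlim x))
      have h2 := h1.mul_const (f x)
      convert h2 using 2
      by_cases hx : x ∈ s <;> simp [hx]
  simp only [integral_continuous_mul_eq_zero hf h] at key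
  rw [← integral_indicator hs.measurableSet]
  exact (tendsto_nhds_unique key tendsto_const_nhds)

theorem ae_eq_of_fourierCoeff_eq {f g : 𝕋 → ℂ} (hf : Integrable f μ𝕋) (hg : Integrable g μ𝕋)
    (h : ∀ n, fourierCoeff f n = fourierCoeff g n) : f =ᵐ[μ𝕋] g := by
  have := ae_eq_zero_of_fourierCoeff_eq_zero (hf.sub hg) (fun n => by
    have := fourierCoeff_sub' hf hg n
    rw [h n, sub_self] at this
    exact this)
  filter_upwards [this] with x hx
  exact sub_eq_zero.mp hx

theorem integrable_Lp {p : ℝ≥0∞} [hp : Fact (1 ≤ p)] (f : LpT p) : Integrable f μ𝕋 :=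
  (Lp.memLp f).integrable hp.out

theorem Lp_ext_fourierCoeff {p : ℝ≥0∞} [Fact (1 ≤ p)] {f g : LpT p}
    (h : ∀ n, fourierCoeff f n = fourierCoeff g n) : f = g :=
  Lp.ext (ae_eq_of_fourierCoeff_eq (integrable_Lp f) (integrable_Lp g) h)

theorem norm_fourierCoeff_le {p : ℝ≥0∞} [hp : Fact (1 ≤ p)] (f : LpT p) (n : ℤ) :
    ‖fourierCoeff f n‖ ≤ ‖f‖ := by
  have h1 : ‖fourierCoeff f n‖ ≤ ∫ x, ‖f x‖ ∂μ𝕋 := by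
    unfold fourierCoeff
    refine (norm_integral_le_integral_norm _).trans_eq ?_
    refine integral_congr_ae (Filter.Eventually.of_forall fun x => ?_)
    simp only [norm_smul]
    rw [fourier_apply, Circle.norm_coe, one_mul]
  refine h1.trans ?_
  rw [integral_norm_eq_lintegral_enorm (integrable_Lp f).1, Lp.norm_def]
  refine ENNReal.toReal_mono (Lp.eLpNorm_ne_top f) ?_
  rw [← eLpNorm_one_eq_lintegral_enorm]
  exact eLpNorm_le_eLpNorm_of_exponent_le hp.out (Lp.aestronglyMeasurable f)

/-- The `n`-th Fourier coefficient as a bounded functional on `L^p`. -/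
def coeffL (p : ℝ≥0∞) [Fact (1 ≤ p)] (n : ℤ) : LpT p →L[ℂ] ℂ :=
  LinearMap.mkContinuous
    { toFun := fun f => fourierCoeff f n
      map_add' := fun f g => fourierCoeff_add_Lp p f g n
      map_smul' := fun c f => fourierCoeff_smul_Lp p c f n } 1
    (fun f => by rw [one_mul]; exact norm_fourierCoeff_le f n)

@[simp]
theorem coeffL_apply (p : ℝ≥0∞) [Fact (1 ≤ p)] (n : ℤ) (f : LpT p) :
    coeffL p n f = fourierCoeff f n := rfl

theorem fourierCoeff_fourierLp (p : ℝ≥0∞) [Fact (1 ≤ p)] (k n : ℤ) :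
    fourierCoeff (fourierLp p k : LpT p) n = if n = k then 1 else 0 := by
  rw [fourierCoeff_congr (coeFn_fourierLp p k)]
  exact fourierCoeff_fourier_apply k n

theorem dense_span_fourierLp {p : ℝ≥0∞} [Fact (1 ≤ p)] (hp : p ≠ ∞) :
    Dense (Submodule.span ℂ (Set.range (fourierLp (T := 1) p)) : Set (LpT p)) := by
  rw [dense_iff_closure_eq, ← Submodule.topologicalClosure_coe, span_fourierLp_closure_eq_top hp]
  rfl

theorem clm_ext_fourierLp {p : ℝ≥0∞} [Fact (1 ≤ p)] (hp : p ≠ ∞) {E : Type*}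
    [NormedAddCommGroup E] [NormedSpace ℂ E] {S T : LpT p →L[ℂ] E}
    (h : ∀ n, S (fourierLp p n) = T (fourierLp p n)) : S = T :=
  ContinuousLinearMap.ext_on (dense_span_fourierLp hp) (by rintro _ ⟨n, rfl⟩; exact h n)

/-- The Fourier coefficients of an `L^p` function, `p < ∞`, tend to zero (Riemann–Lebesgue). -/
theorem tendsto_fourierCoeff_atTop {p : ℝ≥0∞} [Fact (1 ≤ p)] (hp : p ≠ ∞) (f : LpT p) :
    Filter.Tendsto (fun n : ℕ => fourierCoeff f n) Filter.atTop (nhds 0) := by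
  rw [Metric.tendsto_atTop]
  intro ε hε
  obtain ⟨g, hg, hfg⟩ := Metric.dense_iff.mp (dense_span_fourierLp hp) f ε hε
  have hN : ∃ N : ℕ, ∀ n : ℕ, N ≤ n → fourierCoeff g n = 0 := by
    refine Submodule.span_induction ?_ ?_ ?_ ?_ hfg
    · rintro _ ⟨k, rfl⟩
      refine ⟨k.toNat + 1, fun n hn => ?_⟩
      rw [fourierCoeff_fourierLp, if_neg (by omega)]
    · exact ⟨0, fun n _ => fourierCoeff_zero_Lp p n⟩
    · rintro a b _ _ ⟨N, hN⟩ ⟨M, hM⟩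
      refine ⟨max N M, fun n hn => ?_⟩
      rw [fourierCoeff_add_Lp, hN n (by omega), hM n (by omega), add_zero]
    · rintro c a _ ⟨N, hN⟩
      exact ⟨N, fun n hn => by rw [fourierCoeff_smul_Lp, hN n hn, mul_zero]⟩
  obtain ⟨N, hN⟩ := hN
  refine ⟨N, fun n hn => ?_⟩
  have h1 : fourierCoeff f n = coeffL p n (f - g) := by
    rw [map_sub, coeffL_apply, coeffL_apply, hN n hn, sub_zero]
  rw [dist_zero_right, h1]
  refine (norm_fourierCoeff_le _ _).trans_lt ?_
  rw [← dist_eq_norm, dist_comm]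
  exact hg

/-! ### The dual of `L^p` of a finite measure -/

theorem norm_toLp_eq_integral {α : Type*} [MeasurableSpace α] {μ : Measure α} {p : ℝ≥0∞}
    [Fact (1 ≤ p)] {f : α → ℂ} (hp : p ≠ ∞) (hf : MemLp f p μ) :
    ‖hf.toLp f‖ = (∫ x, ‖f x‖ ^ p.toReal ∂μ) ^ p.toReal⁻¹ := by
  have hp0 : p ≠ 0 := (lt_of_lt_of_le zero_lt_one (Fact.out : 1 ≤ p)).ne'
  rw [Lp.norm_toLp, hf.eLpNorm_eq_integral_rpow_norm hp0 hp, ENNReal.toReal_ofReal]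
  exact Real.rpow_nonneg (integral_nonneg fun x => Real.rpow_nonneg (norm_nonneg _) _) _

section LpDual

variable {α : Type*} [MeasurableSpace α] {μ : Measure α} {p q : ℝ≥0∞} [Fact (1 ≤ p)]
  [Fact (1 ≤ q)]

/-- The bilinear pairing `⟨h, f⟩ = ∫ h f` of `L^q` and `L^p`. -/
abbrev pairing [q.HolderConjugate p] (h : Lp ℂ q μ) : Lp ℂ p μ →L[ℂ] ℂ :=
  (ContinuousLinearMap.mul ℂ ℂ).lpPairing μ q p h

theorem pairing_apply [q.HolderConjugate p] (h : Lp ℂ q μ) (f : Lp ℂ p μ) :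
    pairing h f = ∫ x, h x * f x ∂μ :=
  (ContinuousLinearMap.mul ℂ ℂ).lpPairing_eq_integral h f

variable [IsFiniteMeasure μ]

/-- The set function `E ↦ Λ(1_E)` of a bounded functional `Λ` on `L^p`, `p < ∞`, as a complex
measure. -/
def dualComplexMeasure (hp : p ≠ ∞) (Λ : Lp ℂ p μ →L[ℂ] ℂ) : ComplexMeasure α := by
  classical
  exact
  { measureOf' := fun E =>
      if hE : MeasurableSet E then Λ (indicatorConstLp p hE (measure_ne_top μ E) 1) else 0
    empty' := by
      rw [dif_pos MeasurableSet.empty, indicatorConstLp_empty, map_zero]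
    not_measurable' := fun E hE => dif_neg hE
    m_iUnion' := fun A hA hd => by
      rw [dif_pos (MeasurableSet.iUnion hA)]
      have hU : ∀ s : Finset ℕ, MeasurableSet (⋃ i ∈ s, A i) := fun s =>
        Finset.measurableSet_biUnion s fun i _ => hA i
      have hsum : ∀ s : Finset ℕ, (∑ i ∈ s, indicatorConstLp p (hA i) (measure_ne_top μ _) (1 : ℂ))
          = indicatorConstLp p (hU s) (measure_ne_top μ _) 1 := by
        intro s
        induction s using Finset.induction_on with
        | empty => simp [indicatorConstLp_empty]
        | insert a s ha ih =>
          rw [Finset.sum_insert ha, ih]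
          have hdis : Disjoint (A a) (⋃ i ∈ s, A i) := by
            simp only [Set.disjoint_iUnion_right]
            intro i hi
            exact hd (fun h => ha (h ▸ hi))
          rw [← indicatorConstLp_disjoint_union (hA a) (hU s) (measure_ne_top μ _)
            (measure_ne_top μ _) hdis]
          congr 1
          simp
      have hlim : HasSum (fun i => indicatorConstLp p (hA i) (measure_ne_top μ _) (1 : ℂ))
          (indicatorConstLp p (MeasurableSet.iUnion hA) (measure_ne_top μ _) 1) := by
        unfold HasSum
        simp only [hsum]
        refine tendsto_indicatorConstLp_set hp ?_
        have hanti : Antitone fun s : Finset ℕ => (⋃ i, A i) \ ⋃ i ∈ s, A i := fun s t hst =>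
          Set.sdiff_subset_sdiff_right (Set.biUnion_subset_biUnion_left hst)
        have h0 := tendsto_measure_iInter_atTop (μ := μ)
          (fun s : Finset ℕ => ((MeasurableSet.iUnion hA).diff (hU s)).nullMeasurableSet) hanti
          ⟨∅, measure_ne_top μ _⟩
        have hempty : (⋂ s : Finset ℕ, (⋃ i, A i) \ ⋃ i ∈ s, A i) = ∅ := by
          rw [Set.eq_empty_iff_forall_notMem]
          intro x hx
          rw [Set.mem_iInter] at hx
          obtain ⟨i, hi⟩ := Set.mem_iUnion.mp (hx ∅).1
          exact (hx {i}).2 (by simpa using hi)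
        rw [hempty, measure_empty] at h0
        refine h0.congr fun s => ?_
        have hsub : (⋃ i ∈ s, A i) ⊆ ⋃ i, A i := Set.iUnion₂_subset fun i _ =>
          Set.subset_iUnion A i
        simp only [Function.comp]
        congr 1
        ext x
        simp only [Set.mem_sdiff, Set.mem_symmDiff]
        have := @hsub x
        tauto
      simpa only [dif_pos (hA _)] using Λ.hasSum hlim }

theorem dualComplexMeasure_apply (hp : p ≠ ∞) (Λ : Lp ℂ p μ →L[ℂ] ℂ) {E : Set α}
    (hE : MeasurableSet E) :
    dualComplexMeasure hp Λ E = Λ (indicatorConstLp p hE (measure_ne_top μ E) 1) :=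
  dif_pos hE

/-- By the Radon–Nikodym theorem, a bounded functional on `L^p`, `p < ∞`, is given on indicator
functions by an integrable density. -/
theorem exists_density (hp : p ≠ ∞) (Λ : Lp ℂ p μ →L[ℂ] ℂ) :
    ∃ h : α → ℂ, Integrable h μ ∧ ∀ (E : Set α) (hE : MeasurableSet E),
      Λ (indicatorConstLp p hE (measure_ne_top μ E) 1) = ∫ x in E, h x ∂μ := by
  set ν := dualComplexMeasure hp Λ with hν
  have hac : ∀ E, MeasurableSet E → μ E = 0 → ν E = 0 := by
    intro E hE h0
    rw [hν, dualComplexMeasure_apply hp Λ hE]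
    have : indicatorConstLp p hE (measure_ne_top μ E) (1 : ℂ) = 0 := by
      refine Lp.ext ?_
      have h1 := @indicatorConstLp_coeFn α ℂ _ p μ _ E hE (measure_ne_top μ E) (1 : ℂ)
      have h2 : ∀ᵐ x ∂μ, x ∉ E := measure_eq_zero_iff_ae_notMem.mp h0
      filter_upwards [h1, h2, Lp.coeFn_zero ℂ p μ] with x hx hx2 hx3
      rw [hx, hx3, Set.indicator_of_notMem hx2]
      rfl
    rw [this, map_zero]
  have hre := SignedMeasure.withDensityᵥ_rnDeriv_eq (ComplexMeasure.re ν) μ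
    (VectorMeasure.AbsolutelyContinuous.mk fun E hE h0 => by
      rw [Measure.toENNRealVectorMeasure_apply_measurable hE] at h0
      change (ν E).re = 0
      rw [hac E hE h0, Complex.zero_re])
  have him := SignedMeasure.withDensityᵥ_rnDeriv_eq (ComplexMeasure.im ν) μ
    (VectorMeasure.AbsolutelyContinuous.mk fun E hE h0 => by
      rw [Measure.toENNRealVectorMeasure_apply_measurable hE] at h0
      change (ν E).im = 0
      rw [hac E hE h0, Complex.zero_im])
  set a := (ComplexMeasure.re ν).rnDeriv μ
  set b := (ComplexMeasure.im ν).rnDeriv μ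
  have ha : Integrable a μ := SignedMeasure.integrable_rnDeriv _ _
  have hb : Integrable b μ := SignedMeasure.integrable_rnDeriv _ _
  refine ⟨fun x => (a x : ℂ) + b x * Complex.I, ha.ofReal.add (hb.ofReal.mul_const _),
    fun E hE => ?_⟩
  have h1 : ∫ x in E, ((a x : ℂ) + b x * Complex.I) ∂μ
      = ((∫ x in E, a x ∂μ : ℝ) : ℂ) + ((∫ x in E, b x ∂μ : ℝ) : ℂ) * Complex.I := by
    rw [← integral_complex_ofReal, ← integral_complex_ofReal, ← integral_mul_const]
    exact integral_add (ha.ofReal (𝕜 := ℂ)).integrableOn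
      ((hb.ofReal (𝕜 := ℂ)).mul_const Complex.I).integrableOn
  rw [← dualComplexMeasure_apply hp Λ hE, ← hν, h1, ← withDensityᵥ_apply ha hE,
    ← withDensityᵥ_apply hb hE, hre, him]
  exact (Complex.re_add_im (ν E)).symm

theorem clm_ext_indicator (hp : p ≠ ∞) {S T : Lp ℂ p μ →L[ℂ] ℂ}
    (h : ∀ (E : Set α) (hE : MeasurableSet E),
      S (indicatorConstLp p hE (measure_ne_top μ E) 1)
        = T (indicatorConstLp p hE (measure_ne_top μ E) 1)) : S = T := by
  ext f
  induction f using Lp.induction hp with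
  | @indicatorConst c E hs hμs =>
    rw [Lp.simpleFunc.coe_indicatorConst]
    have : indicatorConstLp p hs hμs.ne c
        = c • indicatorConstLp p hs (measure_ne_top μ _) (1 : ℂ) := by
      rw [indicatorConstLp, indicatorConstLp, ← MemLp.toLp_const_smul]
      congr 1
      ext x
      by_cases hx : x ∈ E <;> simp [hx]
    rw [this, map_smul, map_smul, h]
  | add hf hg _ h1 h2 => rw [map_add, map_add, h1, h2]
  | isClosed => exact isClosed_eq S.continuous T.continuous

variable [q.HolderConjugate p]

theorem pairing_indicatorConstLp (h : Lp ℂ q μ) {E : Set α} (hE : MeasurableSet E) :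
    pairing h (indicatorConstLp p hE (measure_ne_top μ E) 1) = ∫ x in E, h x ∂μ := by
  rw [pairing_apply, ← integral_indicator hE]
  refine integral_congr_ae ?_
  filter_upwards [@indicatorConstLp_coeFn α ℂ _ p μ _ E hE (measure_ne_top μ E) (1 : ℂ)] with x hx
  rw [hx]
  by_cases hxE : x ∈ E <;> simp [hxE]

/-- A bounded density that represents a functional on `L^p` has `L^q` norm at most the norm of the
functional: test against the extremal function `conj h · |h|^(q - 2)`. -/
theorem eLpNorm_le_of_represents (hp : p ≠ ∞) (hq : q ≠ ∞) {Λ : Lp ℂ p μ →L[ℂ] ℂ} {C : ℝ}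
    {h : α → ℂ} (hm : AEStronglyMeasurable h μ) {N : ℝ} (hN : ∀ x, ‖h x‖ ≤ N)
    (hΛ : ∀ (g : α → ℂ) (hg : MemLp g p μ), (∀ x, h x = 0 → g x = 0) →
      Λ (hg.toLp g) = ∫ x, h x * g x ∂μ)
    (hC : ‖Λ‖ ≤ C) : eLpNorm h q μ ≤ ENNReal.ofReal C := by
  have hpq : q.toReal.HolderConjugate p.toReal := ENNReal.HolderConjugate.toReal_of_ne_top hq hp
  set s := q.toReal
  set r := p.toReal
  have hs1 : 1 < s := hpq.lt
  have hhq : MemLp h q μ := (memLp_top_of_bound hm N (Filter.Eventually.of_forall hN)).mono_exponent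
    le_top
  have hq0 : q ≠ 0 := (lt_of_lt_of_le zero_lt_one (Fact.out : 1 ≤ q)).ne'
  let g : α → ℂ := fun x => conj (h x) * ((‖h x‖ ^ (s - 2) : ℝ) : ℂ)
  have hgn : ∀ x, ‖g x‖ = ‖h x‖ ^ (s - 1) := fun x => by
    simp only [g, norm_mul, RCLike.norm_conj, Complex.norm_real]
    rw [Real.norm_of_nonneg (Real.rpow_nonneg (norm_nonneg _) _)]
    rcases eq_or_ne (‖h x‖) 0 with h0 | h0
    · rw [h0, zero_mul, Real.zero_rpow (by linarith)]
    · rw [show s - 1 = 1 + (s - 2) by ring,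
        Real.rpow_add (lt_of_le_of_ne (norm_nonneg _) h0.symm), Real.rpow_one]
  have hgm : AEStronglyMeasurable g μ := by
    have h1 : AEStronglyMeasurable (fun x => ‖h x‖ ^ (s - 2)) μ :=
      (hm.norm.aemeasurable.pow_const _).aestronglyMeasurable
    exact (Complex.continuous_conj.comp_aestronglyMeasurable hm).mul
      (Complex.continuous_ofReal.comp_aestronglyMeasurable h1)
  have hgp : MemLp g p μ := by
    refine (memLp_top_of_bound hgm (N ^ (s - 1))
      (Filter.Eventually.of_forall fun x => ?_)).mono_exponent le_top
    rw [hgn]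
    exact Real.rpow_le_rpow (norm_nonneg _) (hN x) (by linarith)
  set I : ℝ := ∫ x, ‖h x‖ ^ s ∂μ with hI
  have hI0 : 0 ≤ I := integral_nonneg fun x => Real.rpow_nonneg (norm_nonneg _) _
  have hgI : ‖hgp.toLp g‖ = I ^ r⁻¹ := by
    rw [norm_toLp_eq_integral hp hgp]
    congr 1
    refine integral_congr_ae (Filter.Eventually.of_forall fun x => ?_)
    simp only [hgn]
    rw [← Real.rpow_mul (norm_nonneg _), hpq.sub_one_mul_conj]
  have hval : Λ (hgp.toLp g) = (I : ℂ) := by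
    rw [hΛ g hgp (fun x hx => by simp [g, hx]), hI, ← integral_complex_ofReal]
    refine integral_congr_ae (Filter.Eventually.of_forall fun x => ?_)
    simp only [g]
    rw [← mul_assoc, Complex.mul_conj, Complex.normSq_eq_norm_sq, ← Complex.ofReal_mul]
    congr 1
    rcases eq_or_ne (‖h x‖) 0 with h0 | h0
    · rw [h0, Real.zero_rpow (show s ≠ 0 by linarith)]; simp
    · rw [← Real.rpow_natCast, ← Real.rpow_add (lt_of_le_of_ne (norm_nonneg _) h0.symm)]
      congr 1
      push_cast
      ring
  have hle : I ≤ C * I ^ r⁻¹ := by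
    have := Λ.le_opNorm (hgp.toLp g)
    rw [hval, hgI, Complex.norm_real, Real.norm_of_nonneg hI0] at this
    exact this.trans (mul_le_mul_of_nonneg_right hC (Real.rpow_nonneg hI0 _))
  have hfin : I ^ s⁻¹ ≤ C := by
    rcases hI0.eq_or_lt with h0 | h0
    · rw [← h0, Real.zero_rpow (inv_ne_zero (by linarith))]
      exact (norm_nonneg _).trans hC
    · have h1 : I ^ s⁻¹ * I ^ r⁻¹ = I := by
        rw [← Real.rpow_add h0, hpq.inv_add_inv_eq_one, Real.rpow_one]
      have h2 : 0 < I ^ r⁻¹ := Real.rpow_pos_of_pos h0 _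
      refine le_of_mul_le_mul_right ?_ h2
      rw [h1]
      exact hle
  rw [hhq.eLpNorm_eq_integral_rpow_norm hq0 hq]
  exact ENNReal.ofReal_le_ofReal hfin

/-- Every bounded functional on `L^p`, `1 < p < ∞`, is the pairing with an `L^q` function. -/
theorem exists_pairing_eq (hp : p ≠ ∞) (hq : q ≠ ∞) (Λ : Lp ℂ p μ →L[ℂ] ℂ) :
    ∃ h : Lp ℂ q μ, pairing h = Λ := by
  obtain ⟨h', hint', hΛ'⟩ := exists_density hp Λ
  set h := hint'.1.mk h' with hh
  have hae : h' =ᵐ[μ] h := hint'.1.ae_eq_mk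
  have hmeas : StronglyMeasurable h := hint'.1.stronglyMeasurable_mk
  have hint : Integrable h μ := hint'.congr hae
  have hΛ : ∀ (E : Set α) (hE : MeasurableSet E),
      Λ (indicatorConstLp p hE (measure_ne_top μ E) 1) = ∫ x in E, h x ∂μ := fun E hE => by
    rw [hΛ' E hE]
    exact integral_congr_ae (ae_restrict_of_ae hae)
  let S : ℕ → Set α := fun N => {x | ‖h x‖ ≤ N}
  have hS : ∀ N, MeasurableSet (S N) := fun N =>
    measurableSet_le hmeas.norm.measurable measurable_const
  let hN : ℕ → α → ℂ := fun N => (S N).indicator h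
  have hNm : ∀ N, AEStronglyMeasurable (hN N) μ := fun N =>
    (hmeas.indicator (hS N)).aestronglyMeasurable
  have hNb : ∀ N x, ‖hN N x‖ ≤ N := fun N x => by
    by_cases hx : x ∈ S N
    · simp only [hN, Set.indicator_of_mem hx]
      exact hx
    · simp [hN, Set.indicator_of_notMem hx]
  have hNq : ∀ N, MemLp (hN N) q μ := fun N =>
    (memLp_top_of_bound (hNm N) N (Filter.Eventually.of_forall (hNb N))).mono_exponent le_top
  -- On functions supported in `{|h| ≤ N}` the functional is the pairing with a bounded function.
  have hrep : ∀ N (g : α → ℂ) (hg : MemLp g p μ), (∀ x, hN N x = 0 → g x = 0) →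
      Λ (hg.toLp g) = ∫ x, hN N x * g x ∂μ := by
    intro N g hg hg0
    let M : Lp ℂ p μ →L[ℂ] Lp ℂ p μ := (ContinuousLinearMap.mul ℂ ℂ).holderL μ ∞ p p
      (indicatorConstLp ∞ (hS N) (measure_ne_top μ _) 1)
    have hM : ∀ f : Lp ℂ p μ, M f =ᵐ[μ] (S N).indicator f := fun f => by
      filter_upwards [(ContinuousLinearMap.mul ℂ ℂ).coeFn_holder (r := p)
        (indicatorConstLp ∞ (hS N) (measure_ne_top μ _) (1 : ℂ)) f,
        @indicatorConstLp_coeFn α ℂ _ ∞ μ _ (S N) (hS N) (measure_ne_top μ _) (1 : ℂ)] with x h1 h2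
      change (ContinuousLinearMap.holder p (ContinuousLinearMap.mul ℂ ℂ) _ f) x = _
      rw [h1, h2]
      by_cases hx : x ∈ S N <;> simp [hx]
    have hclm : Λ ∘L M = pairing (hNq N).toLp := by
      refine clm_ext_indicator hp fun E hE => ?_
      rw [pairing_indicatorConstLp]
      have h1 : M (indicatorConstLp p hE (measure_ne_top μ E) 1)
          = indicatorConstLp p ((hS N).inter hE) (measure_ne_top μ _) 1 := by
        refine Lp.ext ?_
        filter_upwards [hM (indicatorConstLp p hE (measure_ne_top μ E) 1),
          @indicatorConstLp_coeFn α ℂ _ p μ _ E hE (measure_ne_top μ _) (1 : ℂ),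
          @indicatorConstLp_coeFn α ℂ _ p μ _ _ ((hS N).inter hE) (measure_ne_top μ _) (1 : ℂ)]
          with x e1 e2 e3
        rw [e1, e3, Set.indicator_apply, e2]
        by_cases h1 : x ∈ S N <;> by_cases h2 : x ∈ E <;> simp [h1, h2]
      rw [ContinuousLinearMap.comp_apply, h1, hΛ]
      have h2 : ∫ x in E, (hNq N).toLp (hN N) x ∂μ = ∫ x in E, hN N x ∂μ :=
        integral_congr_ae (ae_restrict_of_ae (hNq N).coeFn_toLp)
      rw [h2, Set.inter_comm, setIntegral_indicator (hS N)]
    have hMg : M (hg.toLp g) = hg.toLp g := by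
      refine Lp.ext ?_
      filter_upwards [hM (hg.toLp g), hg.coeFn_toLp] with x e1 e2
      rw [e1]
      by_cases hx : x ∈ S N
      · rw [Set.indicator_of_mem hx]
      · rw [Set.indicator_of_notMem hx, e2, hg0 x (Set.indicator_of_notMem hx h)]
    have := congrArg (fun T : Lp ℂ p μ →L[ℂ] ℂ => T (hg.toLp g)) hclm
    simp only [ContinuousLinearMap.comp_apply, hMg] at this
    rw [this, pairing_apply]
    refine integral_congr_ae ?_
    filter_upwards [(hNq N).coeFn_toLp, hg.coeFn_toLp] with x e1 e2
    rw [e1, e2]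
  have hbound : eLpNorm h q μ ≤ ENNReal.ofReal ‖Λ‖ := by
    refine Lp.eLpNorm_le_of_ae_tendsto (u := Filter.atTop) (f := hN)
      (Filter.Eventually.of_forall fun N =>
        eLpNorm_le_of_represents hp hq (hNm N) (hNb N) (hrep N) le_rfl) hNm
      (Filter.Eventually.of_forall fun x => ?_)
    refine tendsto_const_nhds.congr' ?_
    obtain ⟨N₀, hN₀⟩ := exists_nat_ge ‖h x‖
    filter_upwards [Filter.eventually_ge_atTop N₀] with N hNN
    have : x ∈ S N := hN₀.trans (by exact_mod_cast hNN)
    simp only [hN, Set.indicator_of_mem this]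
  have hq' : MemLp h q μ := ⟨hint.1, hbound.trans_lt ENNReal.ofReal_lt_top⟩
  refine ⟨hq'.toLp h, clm_ext_indicator hp fun E hE => ?_⟩
  rw [pairing_indicatorConstLp, hΛ E hE]
  exact integral_congr_ae (ae_restrict_of_ae hq'.coeFn_toLp)

end LpDual

/-! ### Boundedness of the Riesz projection -/

/-- For `1 < p ≤ 2` the cosine of `p θ` is bounded away from zero, with negative sign, for `θ` near
`± π / 2`. This lets `Re (z ^ p)` compensate for the smallness of `Re z` there. -/
theorem exists_norm_rpow_le (p : ℝ) (hp1 : 1 < p) (hp2 : p ≤ 2) :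
    ∃ A B : ℝ, 0 ≤ A ∧ 0 ≤ B ∧ ∀ z : ℂ, 0 < z.re →
      ‖z‖ ^ p ≤ A * z.re ^ p - B * (z ^ (p : ℂ)).re := by
  have hpi := Real.pi_pos
  -- An angle between `π / (2 p)` and `π / 2`.
  set θ₀ : ℝ := (Real.pi / (2 * p) + Real.pi / 2) / 2 with hθ₀
  have h1 : Real.pi / (2 * p) < Real.pi / 2 := by
    apply div_lt_div_of_pos_left hpi (by norm_num) (by linarith)
  have hθlo : Real.pi / (2 * p) < θ₀ := by rw [hθ₀]; linarith
  have hθhi : θ₀ < Real.pi / 2 := by rw [hθ₀]; linarith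
  have hθpos : 0 < θ₀ := lt_trans (by positivity) hθlo
  have hpθ : Real.pi / 2 < p * θ₀ := by
    calc Real.pi / 2 = p * (Real.pi / (2 * p)) := by field_simp
      _ < p * θ₀ := by gcongr
  have hpθ' : p * θ₀ ≤ Real.pi := by nlinarith
  set δ : ℝ := -Real.cos (p * θ₀) with hδ
  have hδpos : 0 < δ := by
    have := Real.cos_neg_of_pi_div_two_lt_of_lt hpθ (by linarith)
    rw [hδ]; linarith
  set c : ℝ := Real.cos θ₀ with hc
  have hcpos : 0 < c := Real.cos_pos_of_mem_Ioo ⟨by linarith, hθhi⟩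
  have hcp : 0 < c ^ p := Real.rpow_pos_of_pos hcpos p
  refine ⟨(1 + δ⁻¹) / c ^ p, δ⁻¹, by positivity, by positivity, fun z hz => ?_⟩
  have hz0 : z ≠ 0 := fun h => by rw [h, Complex.zero_re] at hz; exact lt_irrefl _ hz
  have hn : 0 < ‖z‖ := norm_pos_iff.mpr hz0
  have harg : |z.arg| < Real.pi / 2 := Complex.abs_arg_lt_pi_div_two_iff.mpr (Or.inl hz)
  have hcos : 0 < Real.cos z.arg := by
    rw [← Real.cos_abs]
    exact Real.cos_pos_of_mem_Ioo ⟨by linarith [abs_nonneg z.arg], harg⟩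
  have hre : z.re = ‖z‖ * Real.cos z.arg := (Complex.norm_mul_cos_arg z).symm
  have hkey : 1 ≤ (1 + δ⁻¹) / c ^ p * Real.cos z.arg ^ p - δ⁻¹ * Real.cos (z.arg * p) := by
    rw [← Real.cos_abs (z.arg * p), abs_mul, abs_of_pos (by linarith : 0 < p),
      ← Real.cos_abs z.arg]
    rw [← Real.cos_abs z.arg] at hcos
    set t := |z.arg|
    have ht0 : 0 ≤ t := abs_nonneg _
    rcases le_or_gt θ₀ t with hge | hlt
    · have h2 : Real.cos (t * p) ≤ -δ := by
        rw [hδ, neg_neg]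
        refine Real.cos_le_cos_of_nonneg_of_le_pi (by positivity) ?_ ?_
        · nlinarith
        · rw [mul_comm]; gcongr
      have h3 : 1 ≤ -(δ⁻¹ * Real.cos (t * p)) := by
        have : δ⁻¹ * Real.cos (t * p) ≤ δ⁻¹ * -δ := by gcongr
        rw [mul_neg, inv_mul_cancel₀ hδpos.ne'] at this
        linarith
      have h4 : 0 ≤ (1 + δ⁻¹) / c ^ p * Real.cos t ^ p := by positivity
      linarith
    · have h2 : c ≤ Real.cos t :=
        Real.cos_le_cos_of_nonneg_of_le_pi ht0 (by linarith) hlt.le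
      have h3 : c ^ p ≤ Real.cos t ^ p := Real.rpow_le_rpow hcpos.le h2 (by linarith)
      have h4 : 1 + δ⁻¹ ≤ (1 + δ⁻¹) / c ^ p * Real.cos t ^ p := by
        rw [div_mul_eq_mul_div, le_div_iff₀ hcp]
        gcongr
      have h5 : δ⁻¹ * Real.cos (t * p) ≤ δ⁻¹ * 1 := by
        gcongr
        exact Real.cos_le_one _
      linarith
  rw [Complex.cpow_ofReal_re, hre, Real.mul_rpow hn.le hcos.le]
  have hnp : 0 < ‖z‖ ^ p := Real.rpow_pos_of_pos hn p
  calc ‖z‖ ^ p = ‖z‖ ^ p * 1 := (mul_one _).symm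
    _ ≤ ‖z‖ ^ p * ((1 + δ⁻¹) / c ^ p * Real.cos z.arg ^ p - δ⁻¹ * Real.cos (z.arg * p)) := by
      gcongr
    _ = _ := by ring

theorem norm_fourier_apply (n : ℤ) (x : 𝕋) : ‖(fourier n x : ℂ)‖ = 1 := by
  rw [fourier_apply, Circle.norm_coe]

theorem exists_fourier_one_eq {z : ℂ} (hz : ‖z‖ = 1) : ∃ x : 𝕋, (fourier 1 x : ℂ) = z := by
  refine ⟨((Complex.arg z / (2 * Real.pi) : ℝ) : 𝕋), ?_⟩
  rw [fourier_coe_apply]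
  have h := Complex.norm_mul_exp_arg_mul_I z
  rw [hz, Complex.ofReal_one, one_mul] at h
  conv_rhs => rw [← h]
  congr 1
  have : (Real.pi : ℂ) ≠ 0 := Complex.ofReal_ne_zero.mpr Real.pi_ne_zero
  push_cast
  field_simp

theorem integral_circle_eq_circleAverage (G : ℂ → ℂ) :
    ∫ x : 𝕋, G (fourier 1 x) ∂μ𝕋 = Real.circleAverage G 0 1 := by
  have h := fourierCoeff_eq_intervalIntegral (T := 1) (fun x : 𝕋 => G (fourier 1 x)) 0 0
  simp only [fourierCoeff, neg_zero, fourier_zero, one_smul, zero_add, div_one] at h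
  rw [h, Real.circleAverage_def]
  have h2 := intervalIntegral.integral_comp_mul_left (a := 0) (b := 1)
    (fun θ => G (circleMap 0 1 θ)) (c := 2 * Real.pi) (by positivity)
  rw [mul_zero, mul_one] at h2
  rw [← h2]
  refine intervalIntegral.integral_congr fun x _ => ?_
  simp only [circleMap, fourier_coe_apply]
  congr 1
  push_cast
  rw [zero_add, one_mul]
  congr 1
  ring

/-- The maximum principle for `exp (-F)`: positivity of the real part on the circle propagates to
the disc. -/
theorem re_pos_of_re_pos_on_circle {F : ℂ → ℂ} (hF : Differentiable ℂ F)
    (hpos : ∀ x : 𝕋, 0 < (F (fourier 1 x)).re) {z : ℂ} (hz : ‖z‖ ≤ 1) : 0 < (F z).re := by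
  obtain ⟨x₀, hx₀⟩ : ∃ x₀ : 𝕋, ∀ x : 𝕋, (F (fourier 1 x₀)).re ≤ (F (fourier 1 x)).re := by
    have hcont : Continuous fun x : 𝕋 => (F (fourier 1 x)).re :=
      Complex.continuous_re.comp (hF.continuous.comp (fourier 1).continuous)
    obtain ⟨x₀, -, h⟩ := isCompact_univ.exists_isMinOn Set.univ_nonempty hcont.continuousOn
    exact ⟨x₀, fun x => h (Set.mem_univ x)⟩
  set m := (F (fourier 1 x₀)).re
  have hball : z ∈ closure (Metric.ball (0 : ℂ) 1) := by
    rw [closure_ball _ one_ne_zero, mem_closedBall_zero_iff]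
    exact hz
  have h := Complex.norm_le_of_forall_mem_frontier_norm_le (f := fun w => Complex.exp (-F w))
    (C := Real.exp (-m)) Metric.isBounded_ball (hF.neg.cexp.diffContOnCl) (fun w hw => by
      rw [frontier_ball _ one_ne_zero, mem_sphere_zero_iff_norm] at hw
      obtain ⟨x, rfl⟩ := exists_fourier_one_eq hw
      rw [Complex.norm_exp, Real.exp_le_exp, Complex.neg_re]
      exact neg_le_neg (hx₀ x)) hball
  rw [Complex.norm_exp, Real.exp_le_exp, Complex.neg_re] at h
  have := hpos x₀
  linarith

/-- For `F` analytic with positive real part, the mean value property of `F ^ p` and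
`exists_norm_rpow_le` bound the `L^p` norm of `F` by that of its real part. -/
theorem exists_integral_norm_rpow_le (p : ℝ) (hp1 : 1 < p) (hp2 : p ≤ 2) :
    ∃ A : ℝ, 0 ≤ A ∧ ∀ F : ℂ → ℂ, Differentiable ℂ F → (∀ x : 𝕋, 0 < (F (fourier 1 x)).re) →
      (F 0).im = 0 →
      ∫ x : 𝕋, ‖F (fourier 1 x)‖ ^ p ∂μ𝕋 ≤ A * ∫ x : 𝕋, (F (fourier 1 x)).re ^ p ∂μ𝕋 := by
  obtain ⟨A, B, hA, hB, h⟩ := exists_norm_rpow_le p hp1 hp2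
  refine ⟨A, hA, fun F hF hpos him => ?_⟩
  have hdisc : ∀ z : ℂ, ‖z‖ ≤ 1 → 0 < (F z).re := fun z hz =>
    re_pos_of_re_pos_on_circle hF hpos hz
  have hFc : Continuous fun x : 𝕋 => F (fourier 1 x) := hF.continuous.comp (fourier 1).continuous
  have hpow : Continuous fun x : 𝕋 => F (fourier 1 x) ^ (p : ℂ) :=
    hFc.cpow continuous_const fun x => Or.inl (hpos x)
  have hint : ∀ {g : 𝕋 → ℝ}, Continuous g → Integrable g μ𝕋 := fun hg =>
    hg.integrable_of_hasCompactSupport (HasCompactSupport.of_compactSpace _)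
  have hmean : ∫ x : 𝕋, (F (fourier 1 x) ^ (p : ℂ)).re ∂μ𝕋 = (F 0 ^ (p : ℂ)).re := by
    have h1 : ∫ x : 𝕋, F (fourier 1 x) ^ (p : ℂ) ∂μ𝕋 = F 0 ^ (p : ℂ) := by
      rw [integral_circle_eq_circleAverage (fun z => F z ^ (p : ℂ))]
      refine DiffContOnCl.circleAverage ?_
      refine DifferentiableOn.diffContOnCl fun z hz => ?_
      refine (hF z).differentiableWithinAt.cpow (differentiableWithinAt_const _) (Or.inl ?_)
      rw [abs_one, closure_ball _ one_ne_zero, mem_closedBall_zero_iff] at hz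
      exact hdisc z hz
    have hpi : Integrable (fun x : 𝕋 => F (fourier 1 x) ^ (p : ℂ)) μ𝕋 :=
      hpow.integrable_of_hasCompactSupport (HasCompactSupport.of_compactSpace _)
    rw [← h1]
    exact integral_re hpi
  have hF0 : 0 ≤ (F 0 ^ (p : ℂ)).re := by
    have h0 : F 0 = ((F 0).re : ℂ) := Complex.ext rfl (by rw [him, Complex.ofReal_im])
    rw [h0, ← Complex.ofReal_cpow (hdisc 0 (by simp)).le, Complex.ofReal_re]
    exact Real.rpow_nonneg (hdisc 0 (by simp)).le _
  have hrec : Continuous fun x : 𝕋 => (F (fourier 1 x)).re ^ p :=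
    (Complex.continuous_re.comp hFc).rpow_const fun x => Or.inr (by linarith)
  have hrepow : Continuous fun x : 𝕋 => (F (fourier 1 x) ^ (p : ℂ)).re :=
    Complex.continuous_re.comp hpow
  calc ∫ x : 𝕋, ‖F (fourier 1 x)‖ ^ p ∂μ𝕋
      ≤ ∫ x : 𝕋, (A * (F (fourier 1 x)).re ^ p - B * (F (fourier 1 x) ^ (p : ℂ)).re) ∂μ𝕋 := by
        refine integral_mono (hint ?_) (hint ?_) fun x => h _ (hpos x)
        · exact hFc.norm.rpow_const fun x => Or.inr (by linarith)
        · exact (hrec.const_mul A).sub (hrepow.const_mul B)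
    _ = A * ∫ x : 𝕋, (F (fourier 1 x)).re ^ p ∂μ𝕋 - B * (F 0 ^ (p : ℂ)).re := by
        rw [integral_sub ((hint hrec).const_mul A) ((hint hrepow).const_mul B),
          integral_const_mul, integral_const_mul, hmean]
    _ ≤ _ := by
        have := mul_nonneg hB hF0
        linarith

/-- The trigonometric polynomial `∑ c_n t^n`. -/
def trigSum : (ℤ →₀ ℂ) →ₗ[ℂ] C(𝕋, ℂ) := Finsupp.linearCombination ℂ (fun n => fourier n)

/-- The analytic part `∑_{n ≥ 0} c_n t^n` of a trigonometric polynomial. -/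
def trigSumNonneg : (ℤ →₀ ℂ) →ₗ[ℂ] C(𝕋, ℂ) :=
  Finsupp.linearCombination ℂ (fun n => if 0 ≤ n then fourier n else 0)

/-- The polynomial `∑_{n ≥ 0} c_n z^n` in the complex variable `z`. -/
def anaPoly (c : ℤ →₀ ℂ) (z : ℂ) : ℂ := c.sum fun n a => a * if 0 ≤ n then z ^ n.toNat else 0

theorem differentiable_anaPoly (c : ℤ →₀ ℂ) : Differentiable ℂ (anaPoly c) := by
  unfold anaPoly Finsupp.sum
  refine Differentiable.fun_sum fun n _ => ?_
  dsimp only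
  split_ifs
  · fun_prop
  · fun_prop

theorem anaPoly_fourier_one (c : ℤ →₀ ℂ) (x : 𝕋) :
    anaPoly c (fourier 1 x) = trigSumNonneg c x := by
  unfold anaPoly trigSumNonneg
  rw [Finsupp.linearCombination_apply]
  unfold Finsupp.sum
  rw [ContinuousMap.sum_apply]
  refine Finset.sum_congr rfl fun n _ => ?_
  rw [ContinuousMap.smul_apply, smul_eq_mul]
  dsimp only
  split_ifs with h
  · congr 1
    lift n to ℕ using h
    rw [Int.toNat_natCast, fourier_one, fourier_apply, natCast_zsmul, toCircle_nsmul]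
    push_cast
    rfl
  · rfl

theorem anaPoly_zero (c : ℤ →₀ ℂ) : anaPoly c 0 = c 0 := by
  unfold anaPoly
  rw [Finsupp.sum, Finset.sum_eq_single 0]
  · simp
  · intro n _ hn
    split_ifs with h
    · rw [zero_pow (by omega), mul_zero]
    · rw [mul_zero]
  · intro h
    rw [Finsupp.notMem_support_iff.mp h, zero_mul]

theorem integrable_continuousMap (f : C(𝕋, ℂ)) : Integrable f μ𝕋 :=
  f.continuous.integrable_of_hasCompactSupport (HasCompactSupport.of_compactSpace _)

theorem fourierCoeff_linearCombination (v : ℤ → C(𝕋, ℂ)) (c : ℤ →₀ ℂ) (n : ℤ) :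
    fourierCoeff (Finsupp.linearCombination ℂ v c) n
      = c.sum fun k a => a * fourierCoeff (v k) n := by
  induction c using Finsupp.induction_linear with
  | zero => simp [fourierCoeff]
  | add a b ha hb =>
    rw [map_add, ContinuousMap.coe_add,
      fourierCoeff.add (integrable_continuousMap _) (integrable_continuousMap _), Pi.add_apply, ha,
      hb, Finsupp.sum_add_index' (by simp) (by intros; ring)]
  | single k a =>
    rw [Finsupp.linearCombination_single, ContinuousMap.coe_smul, fourierCoeff.const_smul,
      Finsupp.sum_single_index (by simp), smul_eq_mul]

theorem fourierCoeff_trigSum (c : ℤ →₀ ℂ) (n : ℤ) : fourierCoeff (trigSum c) n = c n := by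
  unfold trigSum
  rw [fourierCoeff_linearCombination]
  rw [Finsupp.sum, Finset.sum_eq_single n]
  · rw [fourierCoeff_fourier_apply, if_pos rfl, mul_one]
  · intro k _ hk
    rw [fourierCoeff_fourier_apply, if_neg hk.symm, mul_zero]
  · intro h
    rw [Finsupp.notMem_support_iff.mp h, zero_mul]

theorem fourierCoeff_trigSumNonneg (c : ℤ →₀ ℂ) (n : ℤ) :
    fourierCoeff (trigSumNonneg c) n = if 0 ≤ n then c n else 0 := by
  unfold trigSumNonneg
  rw [fourierCoeff_linearCombination]
  have h0 : ∀ m, fourierCoeff (⇑(0 : C(𝕋, ℂ))) m = 0 := fun m => by simp [fourierCoeff]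
  rw [Finsupp.sum, Finset.sum_eq_single n]
  · split_ifs with h
    · rw [fourierCoeff_fourier_apply, if_pos rfl, mul_one]
    · rw [h0, mul_zero]
  · intro k _ hk
    split_ifs
    · rw [fourierCoeff_fourier_apply, if_neg hk.symm, mul_zero]
    · rw [h0, mul_zero]
  · intro h
    rw [Finsupp.notMem_support_iff.mp h, zero_mul]

theorem continuousMap_ext_fourierCoeff {f g : C(𝕋, ℂ)}
    (h : ∀ n, fourierCoeff f n = fourierCoeff g n) : f = g := by
  have := ae_eq_of_fourierCoeff_eq (integrable_continuousMap f) (integrable_continuousMap g) h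
  exact DFunLike.coe_injective ((f.continuous.ae_eq_iff_eq μ𝕋 g.continuous).mp this)

theorem range_trigSum : LinearMap.range trigSum = Submodule.span ℂ (Set.range (fourier (T := 1))) :=
  Finsupp.range_linearCombination ℂ

/-- The real part of a trigonometric polynomial is a trigonometric polynomial. -/
theorem exists_trigSum_re (c : ℤ →₀ ℂ) :
    ∃ a : ℤ →₀ ℂ, ∀ x, trigSum a x = ((trigSum c x).re : ℂ) := by
  have hmem : (2⁻¹ : ℂ) • (trigSum c + star (trigSum c)) ∈ LinearMap.range trigSum := by
    have h1 : trigSum c ∈ (fourierSubalgebra (T := 1)).toSubalgebra.toSubmodule := by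
      rw [fourierSubalgebra_coe, ← range_trigSum]
      exact LinearMap.mem_range_self _ c
    have h2 : star (trigSum c) ∈ (fourierSubalgebra (T := 1)).toSubalgebra.toSubmodule :=
      (fourierSubalgebra (T := 1)).star_mem' h1
    rw [range_trigSum, ← fourierSubalgebra_coe]
    exact Submodule.smul_mem _ _ (Submodule.add_mem _ h1 h2)
  obtain ⟨a, ha⟩ := hmem
  refine ⟨a, fun x => ?_⟩
  rw [ha, ContinuousMap.smul_apply, ContinuousMap.add_apply, ContinuousMap.star_apply,
    Complex.star_def, Complex.add_conj, smul_eq_mul]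
  push_cast
  ring

theorem exists_trigSum_near (u : C(𝕋, ℝ)) {ε : ℝ} (hε : 0 < ε) :
    ∃ a : ℤ →₀ ℂ, ∀ x, (trigSum a x).im = 0 ∧ |(trigSum a x).re - u x| < ε := by
  let w : C(𝕋, ℂ) := ⟨fun x => (u x : ℂ), by fun_prop⟩
  have hd : Dense (LinearMap.range trigSum : Set C(𝕋, ℂ)) := by
    rw [range_trigSum, dense_iff_closure_eq, ← Submodule.topologicalClosure_coe,
      span_fourier_closure_eq_top]
    rfl
  obtain ⟨_, hg, c, rfl⟩ := Metric.dense_iff.mp hd w ε hε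
  obtain ⟨a, ha⟩ := exists_trigSum_re c
  refine ⟨a, fun x => ?_⟩
  rw [ha x, Complex.ofReal_im, Complex.ofReal_re]
  refine ⟨rfl, ?_⟩
  have h1 : ‖(trigSum c - w) x‖ < ε := by
    refine lt_of_le_of_lt (ContinuousMap.norm_coe_le_norm _ x) ?_
    rw [← dist_eq_norm]
    exact hg
  refine lt_of_le_of_lt ?_ h1
  have := Complex.abs_re_le_norm ((trigSum c - w) x)
  simpa [w] using this

/-- For a real trigonometric polynomial `a`, the polynomial `F = 2 P a - a_0` has real part `a`. -/
theorem re_trigSumNonneg {a : ℤ →₀ ℂ} (ha : ∀ x, (trigSum a x).im = 0) (x : 𝕋) :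
    (2 * trigSumNonneg a x - a 0).re = (trigSum a x).re ∧ (a 0).im = 0 := by
  have hreal : ∀ n, conj (a (-n)) = a n := fun n => by
    rw [← fourierCoeff_trigSum a n, ← fourierCoeff_trigSum a (-n), ← fourierCoeff_conj]
    congr 1
    ext y
    exact Complex.conj_eq_iff_im.mpr (ha y)
  have h0 : (a 0).im = 0 := Complex.conj_eq_iff_im.mp (by simpa using hreal 0)
  refine ⟨?_, h0⟩
  have key : trigSumNonneg a + star (trigSumNonneg a) = trigSum a + a 0 • fourier 0 := by
    refine continuousMap_ext_fourierCoeff fun n => ?_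
    rw [ContinuousMap.coe_add, ContinuousMap.coe_add,
      fourierCoeff.add (integrable_continuousMap _) (integrable_continuousMap _),
      fourierCoeff.add (integrable_continuousMap _) (integrable_continuousMap _),
      Pi.add_apply, Pi.add_apply, ContinuousMap.coe_smul, fourierCoeff.const_smul,
      fourierCoeff_fourier_apply, fourierCoeff_trigSum, fourierCoeff_trigSumNonneg]
    have hs : fourierCoeff (⇑(star (trigSumNonneg a))) n
        = conj (fourierCoeff (trigSumNonneg a) (-n)) := fourierCoeff_conj _ n
    rw [hs, fourierCoeff_trigSumNonneg, apply_ite conj, hreal, map_zero, smul_eq_mul]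
    rcases lt_trichotomy n 0 with hn | hn | hn
    · rw [if_neg (by omega), if_pos (by omega), if_neg (by omega)]; ring
    · subst hn; simp
    · rw [if_pos (by omega), if_neg (by omega), if_neg (by omega)]; ring
  have h := congrArg Complex.re (congrArg (fun f : C(𝕋, ℂ) => f x) key)
  simp only [ContinuousMap.add_apply, ContinuousMap.star_apply, ContinuousMap.smul_apply,
    Complex.star_def, Complex.add_re, Complex.conj_re, smul_eq_mul, fourier_zero, mul_one] at h
  rw [Complex.sub_re, Complex.mul_re]
  norm_num
  linarith

section RieszBound

variable {p : ℝ≥0∞} [Fact (1 ≤ p)]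

/-- Inclusion of the continuous functions in `L^p(𝕋)`. -/
abbrev toLpT (p : ℝ≥0∞) [Fact (1 ≤ p)] : C(𝕋, ℂ) →L[ℂ] LpT p := ContinuousMap.toLp p μ𝕋 ℂ

theorem coeFn_toLpT (f : C(𝕋, ℂ)) : toLpT p f =ᵐ[μ𝕋] f := ContinuousMap.coeFn_toLp _ _

theorem norm_toLpT_le_sup (f : C(𝕋, ℂ)) {M : ℝ} (hM : 0 ≤ M) (h : ∀ x, ‖f x‖ ≤ M) :
    ‖toLpT p f‖ ≤ M := by
  have h1 := Lp.norm_le_of_ae_bound (f := toLpT p f) hM (by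
    filter_upwards [coeFn_toLpT (p := p) f] with x hx
    rw [hx]
    exact h x)
  refine h1.trans_eq ?_
  rw [show measureUnivNNReal μ𝕋 = 1 by simp [measureUnivNNReal], NNReal.coe_one,
    Real.one_rpow, one_mul]

theorem norm_toLpT_mono {f g : C(𝕋, ℂ)} (h : ∀ x, ‖f x‖ ≤ ‖g x‖) : ‖toLpT p f‖ ≤ ‖toLpT p g‖ := by
  refine Lp.norm_le_norm_of_ae_le ?_
  filter_upwards [coeFn_toLpT (p := p) f, coeFn_toLpT (p := p) g] with x hf hg
  rw [hf, hg]
  exact h x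

theorem norm_toLpT_le_add {f g : C(𝕋, ℂ)} {M : ℝ} (hM : 0 ≤ M) (h : ∀ x, ‖f x‖ ≤ ‖g x‖ + M) :
    ‖toLpT p f‖ ≤ ‖toLpT p g‖ + M := by
  let g' : C(𝕋, ℂ) := ⟨fun x => (‖g x‖ : ℂ), by fun_prop⟩
  let m : C(𝕋, ℂ) := ContinuousMap.const 𝕋 (M : ℂ)
  have h1 : ‖toLpT p f‖ ≤ ‖toLpT p (g' + m)‖ := norm_toLpT_mono fun x => by
    rw [ContinuousMap.add_apply]
    simp only [g', m, ContinuousMap.coe_mk, ContinuousMap.const_apply]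
    rw [← Complex.ofReal_add, Complex.norm_real, Real.norm_of_nonneg (by positivity)]
    exact h x
  have h2 : ‖toLpT p g'‖ ≤ ‖toLpT p g‖ := norm_toLpT_mono fun x => by simp [g']
  have h3 : ‖toLpT p m‖ ≤ M := norm_toLpT_le_sup m hM fun x => by simp [m, abs_of_nonneg hM]
  rw [map_add] at h1
  exact h1.trans ((norm_add_le _ _).trans (add_le_add h2 h3))

theorem norm_toLpT_eq (hp : p ≠ ∞) (f : C(𝕋, ℂ)) :
    ‖toLpT p f‖ = (∫ x, ‖f x‖ ^ p.toReal ∂μ𝕋) ^ p.toReal⁻¹ := by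
  have h := norm_toLp_eq_integral hp (Lp.memLp (toLpT p f))
  rw [Lp.toLp_coeFn] at h
  rw [h]
  congr 1
  refine integral_congr_ae ?_
  filter_upwards [coeFn_toLpT (p := p) f] with x hx
  rw [hx]

theorem fourierCoeff_toLpT (f : C(𝕋, ℂ)) (n : ℤ) :
    fourierCoeff (toLpT p f) n = fourierCoeff f n := fourierCoeff_congr (coeFn_toLpT f) n

/-- For a positive trigonometric polynomial `a` apply `exists_integral_norm_rpow_le` to the
polynomial `F = 2 P a - a_0`, whose real part on the circle is `a`. -/
theorem exists_bound_of_pos (hp1 : 1 < p) (hp2 : p ≤ 2) :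
    ∃ K : ℝ, 0 ≤ K ∧ ∀ a : ℤ →₀ ℂ, (∀ x, (trigSum a x).im = 0) → (∀ x, 0 < (trigSum a x).re) →
      ‖toLpT p (trigSumNonneg a)‖ ≤ K * ‖toLpT p (trigSum a)‖ := by
  have hp : p ≠ ∞ := (hp2.trans_lt (by norm_num)).ne
  have hr1 : 1 < p.toReal := by
    have := (ENNReal.toReal_lt_toReal (by norm_num) hp).mpr hp1
    simpa using this
  have hr2 : p.toReal ≤ 2 := by
    have := (ENNReal.toReal_le_toReal hp (by norm_num)).mpr hp2
    simpa using this
  obtain ⟨A, hA, h⟩ := exists_integral_norm_rpow_le p.toReal hr1 hr2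
  set r := p.toReal
  refine ⟨A ^ r⁻¹ + 1, by positivity, fun a him hpos => ?_⟩
  let Fc : C(𝕋, ℂ) := (2 : ℂ) • trigSumNonneg a - ContinuousMap.const 𝕋 (a 0)
  have hF := h (fun z => 2 * anaPoly a z - a 0)
    (((differentiable_anaPoly a).const_mul 2).sub_const _)
    (fun x => by
      rw [anaPoly_fourier_one, (re_trigSumNonneg him x).1]
      exact hpos x)
    (by
      have h0 := (re_trigSumNonneg him 0).2
      rw [anaPoly_zero, show 2 * a 0 - a 0 = a 0 by ring, h0])
  have hFx : ∀ x, Fc x = 2 * anaPoly a (fourier 1 x) - a 0 := fun x => by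
    rw [anaPoly_fourier_one]; rfl
  have hnF : ‖toLpT p Fc‖ ≤ A ^ r⁻¹ * ‖toLpT p (trigSum a)‖ := by
    rw [norm_toLpT_eq hp, norm_toLpT_eq hp, ← Real.mul_rpow hA
      (integral_nonneg fun x => Real.rpow_nonneg (norm_nonneg _) _)]
    refine Real.rpow_le_rpow (integral_nonneg fun x => Real.rpow_nonneg (norm_nonneg _) _) ?_
      (by positivity)
    simp only [hFx]
    refine hF.trans_eq ?_
    congr 1
    refine integral_congr_ae (Filter.Eventually.of_forall fun x => ?_)
    simp only
    rw [anaPoly_fourier_one, (re_trigSumNonneg him x).1]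
    congr 1
    have : trigSum a x = ((trigSum a x).re : ℂ) :=
      Complex.ext rfl (by rw [him x, Complex.ofReal_im])
    rw [this, Complex.norm_real, Real.norm_of_nonneg (hpos x).le, Complex.ofReal_re]
  have ha0 : ‖a 0‖ ≤ ‖toLpT p (trigSum a)‖ := by
    rw [← fourierCoeff_trigSum a 0, ← fourierCoeff_toLpT (p := p)]
    exact norm_fourierCoeff_le _ 0
  have hc : ‖toLpT p (ContinuousMap.const 𝕋 (a 0))‖ ≤ ‖a 0‖ :=
    norm_toLpT_le_sup _ (norm_nonneg _) fun x => le_rfl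
  have h2 : (2 : ℂ) • toLpT p (trigSumNonneg a)
      = toLpT p Fc + toLpT p (ContinuousMap.const 𝕋 (a 0)) := by
    rw [← map_smul, ← map_add]
    congr 1
    simp [Fc]
  have h3 : 2 * ‖toLpT p (trigSumNonneg a)‖ ≤ (A ^ r⁻¹ + 1) * ‖toLpT p (trigSum a)‖ := by
    have := congrArg norm h2
    rw [norm_smul, Complex.norm_ofNat] at this
    rw [this]
    refine (norm_add_le _ _).trans ?_
    rw [add_mul, one_mul]
    exact add_le_add hnF (hc.trans ha0)
  linarith [norm_nonneg (toLpT p (trigSumNonneg a))]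

/-- A real trigonometric polynomial is a difference of two positive ones, close to its positive and
negative parts. -/
theorem exists_bound_of_real (hp1 : 1 < p) (hp2 : p ≤ 2) :
    ∃ K : ℝ, 0 ≤ K ∧ ∀ c : ℤ →₀ ℂ, (∀ x, (trigSum c x).im = 0) →
      ‖toLpT p (trigSumNonneg c)‖ ≤ K * ‖toLpT p (trigSum c)‖ := by
  obtain ⟨K, hK, h⟩ := exists_bound_of_pos (p := p) hp1 hp2
  refine ⟨2 * K, by positivity, fun c hc => ?_⟩
  have heps : ∀ ε : ℝ, 0 < ε → ‖toLpT p (trigSumNonneg c)‖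
      ≤ 2 * K * ‖toLpT p (trigSum c)‖ + ε * (6 * K) := by
    intro ε hε
    let u : C(𝕋, ℝ) := ⟨fun x => max (trigSum c x).re 0 + 2 * ε, by fun_prop⟩
    obtain ⟨a, ha⟩ := exists_trigSum_near u hε
    have hu : ∀ x, u x = max (trigSum c x).re 0 + 2 * ε := fun x => rfl
    have hnorm : ∀ (b : ℤ →₀ ℂ) x, (trigSum b x).im = 0 →
        ‖trigSum b x‖ = |(trigSum b x).re| := fun b x hb => by
      rw [← Real.norm_eq_abs, ← Complex.norm_real]
      congr 1
      exact Complex.ext rfl (by rw [hb, Complex.ofReal_im])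
    have hb : ∀ x, trigSum (a - c) x = trigSum a x - trigSum c x := fun x => by
      rw [map_sub, ContinuousMap.sub_apply]
    have hbim : ∀ x, (trigSum (a - c) x).im = 0 := fun x => by
      rw [hb, Complex.sub_im, (ha x).1, hc x, sub_zero]
    have h1 := h a (fun x => (ha x).1) (fun x => by
      have := (abs_lt.mp (ha x).2).1
      rw [hu] at this
      linarith [le_max_right (trigSum c x).re 0])
    have h2 := h (a - c) hbim (fun x => by
      have := (abs_lt.mp (ha x).2).1
      rw [hu] at this
      rw [hb, Complex.sub_re]
      linarith [le_max_left (trigSum c x).re 0])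
    have h3 : ‖toLpT p (trigSum a)‖ ≤ ‖toLpT p (trigSum c)‖ + 3 * ε :=
      norm_toLpT_le_add (by positivity) fun x => by
        have h4 := abs_lt.mp (ha x).2
        rw [hu] at h4
        rw [hnorm a x (ha x).1, hnorm c x (hc x), abs_le]
        have h5 : max (trigSum c x).re 0 ≤ |(trigSum c x).re| :=
          max_le (le_abs_self _) (abs_nonneg _)
        have h6 := le_max_right (trigSum c x).re 0
        constructor <;> linarith [abs_nonneg (trigSum c x).re]
    have h3' : ‖toLpT p (trigSum (a - c))‖ ≤ ‖toLpT p (trigSum c)‖ + 3 * ε :=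
      norm_toLpT_le_add (by positivity) fun x => by
        have h4 := abs_lt.mp (ha x).2
        rw [hu] at h4
        rw [hnorm _ x (hbim x), hnorm c x (hc x), abs_le, hb, Complex.sub_re]
        rcases le_total (trigSum c x).re 0 with h5 | h5
        · rw [max_eq_right h5] at h4
          rw [abs_of_nonpos h5]
          constructor <;> linarith
        · rw [max_eq_left h5] at h4
          rw [abs_of_nonneg h5]
          constructor <;> linarith
    have h7 : trigSumNonneg c = trigSumNonneg a - trigSumNonneg (a - c) := by
      rw [map_sub]; abel
    rw [h7, map_sub]
    calc _ ≤ ‖toLpT p (trigSumNonneg a)‖ + ‖toLpT p (trigSumNonneg (a - c))‖ := norm_sub_le _ _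
      _ ≤ K * (‖toLpT p (trigSum c)‖ + 3 * ε) + K * (‖toLpT p (trigSum c)‖ + 3 * ε) :=
        add_le_add (h1.trans (by gcongr)) (h2.trans (by gcongr))
      _ = _ := by ring
  refine le_of_forall_pos_le_add fun δ hδ => ?_
  have hK1 : 0 < 6 * K + 1 := by linarith
  refine (heps (δ / (6 * K + 1)) (by positivity)).trans ?_
  gcongr
  rw [div_mul_eq_mul_div, div_le_iff₀ hK1]
  nlinarith

/-- The bound for complex trigonometric polynomials, by splitting into real and imaginary part. -/
theorem exists_bound_trigSumNonneg (hp1 : 1 < p) (hp2 : p ≤ 2) :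
    ∃ K : ℝ, ∀ c : ℤ →₀ ℂ, ‖toLpT p (trigSumNonneg c)‖ ≤ K * ‖toLpT p (trigSum c)‖ := by
  obtain ⟨K, hK, h⟩ := exists_bound_of_real (p := p) hp1 hp2
  refine ⟨2 * K, fun c => ?_⟩
  obtain ⟨a, ha⟩ := exists_trigSum_re c
  obtain ⟨b, hb⟩ := exists_trigSum_re (-Complex.I • c)
  have hb' : ∀ x, trigSum b x = ((trigSum c x).im : ℂ) := fun x => by
    rw [hb x, map_smul, ContinuousMap.smul_apply]
    simp
  have hc : c = a + Complex.I • b := by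
    ext n
    rw [← fourierCoeff_trigSum c, ← fourierCoeff_trigSum (a + Complex.I • b)]
    congr 2
    ext x
    rw [map_add, map_smul, ContinuousMap.add_apply, ContinuousMap.smul_apply, ha, hb', smul_eq_mul,
      mul_comm Complex.I]
    exact (Complex.re_add_im _).symm
  have h1 : ‖toLpT p (trigSumNonneg a)‖ ≤ K * ‖toLpT p (trigSum c)‖ := by
    refine (h a fun x => by rw [ha, Complex.ofReal_im]).trans ?_
    gcongr
    refine norm_toLpT_mono fun x => ?_
    rw [ha, Complex.norm_real]
    exact Complex.abs_re_le_norm _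
  have h2 : ‖toLpT p (trigSumNonneg b)‖ ≤ K * ‖toLpT p (trigSum c)‖ := by
    refine (h b fun x => by rw [hb', Complex.ofReal_im]).trans ?_
    gcongr
    refine norm_toLpT_mono fun x => ?_
    rw [hb', Complex.norm_real]
    exact Complex.abs_im_le_norm _
  have h3 : trigSumNonneg c = trigSumNonneg a + Complex.I • trigSumNonneg b := by
    rw [← map_smul, ← map_add, ← hc]
  rw [h3, map_add, map_smul]
  refine (norm_add_le _ _).trans ?_
  rw [norm_smul, Complex.norm_I, one_mul]
  linarith

theorem exists_riesz_of_le_two (hp1 : 1 < p) (hp2 : p ≤ 2) :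
    ∃ R : LpT p →L[ℂ] LpT p, ∀ (f : LpT p) (n : ℤ),
      fourierCoeff (R f) n = if 0 ≤ n then fourierCoeff f n else 0 := by
  have hp : p ≠ ∞ := (hp2.trans_lt (by norm_num)).ne
  obtain ⟨K, hK⟩ := exists_bound_trigSumNonneg (p := p) hp1 hp2
  let e : (ℤ →₀ ℂ) →ₗ[ℂ] LpT p := (toLpT p).toLinearMap ∘ₗ trigSum
  let f : (ℤ →₀ ℂ) →ₗ[ℂ] LpT p := (toLpT p).toLinearMap ∘ₗ trigSumNonneg
  have hfl : ∀ k, e (Finsupp.single k 1) = fourierLp p k := fun k => by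
    simp only [e, trigSum, LinearMap.comp_apply, Finsupp.linearCombination_single, one_smul]
    rfl
  have hdense : DenseRange e := by
    refine (dense_span_fourierLp hp).mono ?_
    have : Submodule.span ℂ (Set.range (fourierLp (T := 1) p)) ≤ LinearMap.range e := by
      rw [Submodule.span_le]
      rintro _ ⟨k, rfl⟩
      exact ⟨Finsupp.single k 1, hfl k⟩
    exact this
  let R : LpT p →L[ℂ] LpT p := f.extendOfNorm e
  have hR : ∀ c, R (e c) = f c := fun c => LinearMap.extendOfNorm_eq hdense ⟨K, hK⟩ c
  refine ⟨R, fun g n => ?_⟩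
  have hclm : coeffL p n ∘L R = if 0 ≤ n then coeffL p n else 0 := by
    refine clm_ext_fourierLp hp fun k => ?_
    rw [ContinuousLinearMap.comp_apply, ← hfl, hR, coeffL_apply]
    simp only [f, e, LinearMap.comp_apply]
    change fourierCoeff (toLpT p (trigSumNonneg _)) n = _
    rw [fourierCoeff_toLpT, fourierCoeff_trigSumNonneg]
    split_ifs
    · change _ = fourierCoeff (toLpT p (trigSum _)) n
      rw [fourierCoeff_toLpT, fourierCoeff_trigSum]
    · rfl
  have := congrArg (fun T : LpT p →L[ℂ] ℂ => T g) hclm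
  simp only [ContinuousLinearMap.comp_apply, coeffL_apply] at this
  rw [this]
  split_ifs <;> rfl

/-- The reflection `f(t) ↦ f(t⁻¹)` on `L^p`. -/
def reflL (p : ℝ≥0∞) [Fact (1 ≤ p)] : LpT p →L[ℂ] LpT p :=
  (Lp.compMeasurePreservingₗᵢ ℂ (fun x : 𝕋 => -x)
    (Measure.measurePreserving_neg μ𝕋)).toContinuousLinearMap

theorem coeFn_reflL (f : LpT p) : reflL p f =ᵐ[μ𝕋] fun x => f (-x) :=
  Lp.coeFn_compMeasurePreserving f (Measure.measurePreserving_neg μ𝕋)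

theorem fourierCoeff_reflL (f : LpT p) (n : ℤ) :
    fourierCoeff (reflL p f) n = fourierCoeff f (-n) := by
  rw [fourierCoeff_congr (coeFn_reflL f)]
  exact fourierCoeff_comp_neg f n

theorem pairing_fourierLp {q : ℝ≥0∞} [Fact (1 ≤ q)] [q.HolderConjugate p] (h : LpT q) (n : ℤ) :
    pairing h (fourierLp p n : LpT p) = fourierCoeff h (-n) := by
  rw [pairing_apply, fourierCoeff, neg_neg]
  refine integral_congr_ae ?_
  filter_upwards [coeFn_fourierLp p n] with x hx
  rw [hx, smul_eq_mul, mul_comm]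

/-- Boundedness of the Riesz projection passes from `L^p` to `L^q` by duality. -/
theorem exists_riesz_of_conjugate {q : ℝ≥0∞} [Fact (1 ≤ q)] [hqp : q.HolderConjugate p]
    (hp : p ≠ ∞) (hq : q ≠ ∞)
    (hP : ∃ R : LpT p →L[ℂ] LpT p, ∀ (f : LpT p) (n : ℤ),
      fourierCoeff (R f) n = if 0 ≤ n then fourierCoeff f n else 0) :
    ∃ R : LpT q →L[ℂ] LpT q, ∀ (f : LpT q) (n : ℤ),
      fourierCoeff (R f) n = if 0 ≤ n then fourierCoeff f n else 0 := by
  obtain ⟨R, hR⟩ := hP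
  -- The transpose, with respect to `⟨h, f⟩ = ∫ h f`, of the projection onto the frequencies `≤ 0`.
  let Φ : LpT q →L[ℂ] (LpT p →L[ℂ] ℂ) := (ContinuousLinearMap.mul ℂ ℂ).lpPairing μ𝕋 q p
  have hΦ : Function.Bijective Φ := by
    refine ⟨(injective_iff_map_eq_zero Φ).mpr fun h h0 => ?_, fun Λ => exists_pairing_eq hp hq Λ⟩
    refine Lp_ext_fourierCoeff fun n => ?_
    rw [fourierCoeff_zero_Lp, ← neg_neg n, ← pairing_fourierLp (p := p)]
    exact congrArg (fun T : LpT p →L[ℂ] ℂ => T (fourierLp p (-n))) h0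
  let e : LpT q ≃L[ℂ] (LpT p →L[ℂ] ℂ) := ContinuousLinearEquiv.ofBijective Φ
    (LinearMap.ker_eq_bot.mpr hΦ.1) (LinearMap.range_eq_top.mpr hΦ.2)
  let N : LpT p →L[ℂ] LpT p := reflL p ∘L R ∘L reflL p
  let D : (LpT p →L[ℂ] ℂ) →L[ℂ] (LpT p →L[ℂ] ℂ) :=
    (ContinuousLinearMap.compL ℂ (LpT p) (LpT p) ℂ).flip N
  refine ⟨e.symm.toContinuousLinearMap ∘L D ∘L Φ, fun f n => ?_⟩
  have h1 : Φ (e.symm (D (Φ f))) = D (Φ f) := e.apply_symm_apply (D (Φ f))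
  have h2 : N (fourierLp p (-n)) = if 0 ≤ n then fourierLp p (-n) else 0 := by
    refine Lp_ext_fourierCoeff fun m => ?_
    simp only [N, ContinuousLinearMap.comp_apply]
    rw [fourierCoeff_reflL, hR, fourierCoeff_reflL, neg_neg, fourierCoeff_fourierLp]
    by_cases hn : 0 ≤ n
    · rw [if_pos hn, fourierCoeff_fourierLp]
      split_ifs <;> first | rfl | omega
    · rw [if_neg hn, fourierCoeff_zero_Lp]
      split_ifs <;> first | rfl | omega
  have h3 : fourierCoeff (e.symm (D (Φ f))) n = Φ f (N (fourierLp p (-n))) := by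
    have := pairing_fourierLp (p := p) (e.symm (D (Φ f))) (-n)
    rw [neg_neg] at this
    rw [← this]
    exact congrArg (fun T : LpT p →L[ℂ] ℂ => T (fourierLp p (-n))) h1
  change fourierCoeff (e.symm (D (Φ f))) n = _
  rw [h3, h2]
  split_ifs
  · have := pairing_fourierLp (p := p) f (-n)
    rw [neg_neg] at this
    exact this
  · exact map_zero _

theorem le_two_of_holderConjugate {p q : ℝ≥0∞} [hpq : q.HolderConjugate p] (h : ¬ p ≤ 2) :
    q ≤ 2 := by
  by_contra hq
  have h1 := ENNReal.HolderConjugate.inv_add_inv_eq_one q p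
  have h2 : p⁻¹ < 2⁻¹ := ENNReal.inv_lt_inv.mpr (not_le.mp h)
  have h3 : q⁻¹ < 2⁻¹ := ENNReal.inv_lt_inv.mpr (not_le.mp hq)
  have h4 := ENNReal.add_lt_add h3 h2
  rw [h1, ENNReal.inv_two_add_inv_two] at h4
  exact lt_irrefl _ h4

/-- **M. Riesz' theorem**: the Riesz projection is bounded on `L^p(𝕋)` for `1 < p < ∞`. -/
theorem exists_riesz {q : ℝ≥0∞} [Fact (1 ≤ q)] [hqp : q.HolderConjugate p] (hp : p ≠ ∞)
    (hq : q ≠ ∞) :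
    ∃ R : LpT p →L[ℂ] LpT p, ∀ (f : LpT p) (n : ℤ),
      fourierCoeff (R f) n = if 0 ≤ n then fourierCoeff f n else 0 := by
  have hp1 : 1 < p := (ENNReal.HolderConjugate.lt_top_iff_one_lt q p).mp hq.lt_top
  have hq1 : 1 < q := (ENNReal.HolderConjugate.lt_top_iff_one_lt p q).mp hp.lt_top
  by_cases h : p ≤ 2
  · exact exists_riesz_of_le_two hp1 h
  · exact exists_riesz_of_conjugate hq hp
      (exists_riesz_of_le_two hq1 (le_two_of_holderConjugate (p := p) h))

theorem fourierCoeff_rieszProjection {q : ℝ≥0∞} [Fact (1 ≤ q)] [q.HolderConjugate p] (hp : p ≠ ∞)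
    (hq : q ≠ ∞) (f : LpT p) (n : ℤ) :
    fourierCoeff (⇑(rieszProjection p f : LpT p)) n = if 0 ≤ n then fourierCoeff f n else 0 := by
  have hex : ∃ P : LpT p →L[ℂ] Hp p, ∀ (f : LpT p) (n : ℤ),
      fourierCoeff (⇑(P f : LpT p)) n = if 0 ≤ n then fourierCoeff f n else 0 := by
    obtain ⟨R, hR⟩ := exists_riesz (p := p) (q := q) hp hq
    exact ⟨R.codRestrict (Hp p) fun f n hn => by rw [hR, if_neg (by omega)], hR⟩
  unfold rieszProjection
  rw [dif_pos hex]
  exact hex.choose_spec f n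

end RieszBound

/-! ### Products of functions with one-sided spectrum -/

/-- The Fourier coefficients of `f` vanish above the frequency `a`. -/
def SpecLE (f : 𝕋 → ℂ) (a : ℤ) : Prop := ∀ n : ℤ, a < n → fourierCoeff f n = 0

theorem SpecLE.congr {f g : 𝕋 → ℂ} {a : ℤ} (hf : SpecLE f a) (h : f =ᵐ[μ𝕋] g) : SpecLE g a :=
  fun n hn => by rw [← fourierCoeff_congr h, hf n hn]

theorem memConjHardy_iff {p : ℝ≥0∞} {f : 𝕋 → ℂ} :
    MemConjHardy p f ↔ MemLp f p μ𝕋 ∧ SpecLE f 0 := by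
  unfold MemConjHardy MemHardy SpecLE
  have hstar : ∀ {g : 𝕋 → ℂ}, MemLp g p μ𝕋 → MemLp (fun x => conj (g x)) p μ𝕋 := fun hg =>
    hg.of_le (Complex.continuous_conj.comp_aestronglyMeasurable hg.1)
      (Filter.Eventually.of_forall fun x => by rw [RCLike.norm_conj])
  refine and_congr ⟨fun h => ?_, hstar⟩ ⟨fun h n hn => ?_, fun h n hn => ?_⟩
  · simpa using hstar h
  · have := h (-n) (by omega)
    rw [fourierCoeff_conj, neg_neg] at this
    exact (map_eq_zero _).mp this
  · rw [fourierCoeff_conj, h (-n) (by omega), map_zero]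

theorem coeFn_mulOp {p : ℝ≥0∞} [Fact (1 ≤ p)] (φ : LpT ∞) (f : LpT p) :
    mulOp p φ f =ᵐ[μ𝕋] fun x => φ x * f x :=
  (ContinuousLinearMap.mul ℂ ℂ).coeFn_holder (r := p) φ f

theorem fourierCoeff_mulOp_fourierLp {p : ℝ≥0∞} [Fact (1 ≤ p)] (k : ℤ) (f : LpT p) (n : ℤ) :
    fourierCoeff (mulOp p (fourierLp ∞ k) f) n = fourierCoeff f (n - k) := by
  rw [← fourierCoeff_fourier_mul]
  refine fourierCoeff_congr ?_ n
  filter_upwards [coeFn_mulOp (fourierLp ∞ k) f, coeFn_fourierLp (T := 1) ∞ k] with x h1 h2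
  rw [h1, h2]

theorem integrable_mul_of_memLp {p q : ℝ≥0∞} [p.HolderConjugate q] {f g : 𝕋 → ℂ} (hf : MemLp f p μ𝕋)
    (hg : MemLp g q μ𝕋) : Integrable (fun x => f x * g x) μ𝕋 := hf.integrable_mul hg

section Product

variable {p q : ℝ≥0∞} [Fact (1 ≤ p)] [Fact (1 ≤ q)]

/-- The projection of `L^q` onto the frequencies `≤ b`. -/
def truncLE (q : ℝ≥0∞) [Fact (1 ≤ q)] (b : ℤ) : LpT q →L[ℂ] LpT q :=
  ContinuousLinearMap.id ℂ _ - mulOp q (fourierLp ∞ (b + 1)) ∘L (Hp q).subtypeL ∘L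
    rieszProjection q ∘L mulOp q (fourierLp ∞ (-(b + 1)))

theorem fourierCoeff_sub_Lp (f g : LpT p) (n : ℤ) :
    fourierCoeff (⇑(f - g)) n = fourierCoeff f n - fourierCoeff g n := by
  rw [← coeffL_apply, map_sub]; rfl

theorem fourierCoeff_truncLE [p.HolderConjugate q] (hp : p ≠ ∞) (hq : q ≠ ∞) (b : ℤ) (g : LpT q)
    (n : ℤ) : fourierCoeff (truncLE q b g) n = if n ≤ b then fourierCoeff g n else 0 := by
  unfold truncLE
  simp only [sub_apply, ContinuousLinearMap.comp_apply,
    ContinuousLinearMap.id_apply, Submodule.subtypeL_apply]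
  rw [fourierCoeff_sub_Lp, fourierCoeff_mulOp_fourierLp,
    fourierCoeff_rieszProjection (q := p) hq hp, fourierCoeff_mulOp_fourierLp,
    show n - (b + 1) - -(b + 1) = n by ring]
  split_ifs with h1 h2 h2
  · omega
  · rw [sub_self]
  · rw [sub_zero]
  · omega

/-- The product of functions with spectra bounded above by `a` and `b` has spectrum bounded by
`a + b`, and the leading coefficients multiply. By density of trigonometric polynomials and the
boundedness of `truncLE` it is enough to treat a monomial as second factor. -/
theorem fourierCoeff_mul_of_specLE [hpq : p.HolderConjugate q] (hp : p ≠ ∞) (hq : q ≠ ∞)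
    {f g : 𝕋 → ℂ} (hf : MemLp f p μ𝕋) (hg : MemLp g q μ𝕋) {a b : ℤ} (hfa : SpecLE f a)
    (hgb : SpecLE g b) {n : ℤ} (hn : a + b ≤ n) :
    fourierCoeff (fun x => f x * g x) n
      = if n = a + b then fourierCoeff f a * fourierCoeff g b else 0 := by
  have hfn : MemLp (fun x => fourier (-n) x * f x) p μ𝕋 := memLp_fourier_mul hf (-n)
  have key : (pairing hfn.toLp : LpT q →L[ℂ] ℂ) ∘L truncLE q b
      = if n = a + b then fourierCoeff f a • coeffL q b else 0 := by
    refine clm_ext_fourierLp hq fun k => ?_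
    have htr : truncLE q b (fourierLp q k) = if k ≤ b then fourierLp q k else 0 := by
      refine Lp_ext_fourierCoeff fun m => ?_
      rw [fourierCoeff_truncLE hp hq, fourierCoeff_fourierLp]
      by_cases hk : k ≤ b
      · rw [if_pos hk, fourierCoeff_fourierLp]
        split_ifs <;> first | rfl | omega
      · rw [if_neg hk, fourierCoeff_zero_Lp]
        split_ifs <;> first | rfl | omega
    have hright : (if n = a + b then fourierCoeff f a • coeffL q b else 0 : LpT q →L[ℂ] ℂ)
        (fourierLp q k) = if n = a + b then (if b = k then fourierCoeff f a else 0) else 0 := by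
      by_cases h1 : n = a + b
      · rw [if_pos h1, if_pos h1, smul_apply, coeffL_apply,
          fourierCoeff_fourierLp, smul_eq_mul, mul_ite, mul_one, mul_zero]
      · rw [if_neg h1, if_neg h1]; rfl
    rw [hright, ContinuousLinearMap.comp_apply, htr]
    by_cases hk : k ≤ b
    · rw [if_pos hk, pairing_fourierLp, fourierCoeff_congr hfn.coeFn_toLp,
        fourierCoeff_fourier_mul, show -k - -n = n - k by ring]
      by_cases h1 : n = a + b
      · rw [if_pos h1]
        by_cases h2 : b = k
        · rw [if_pos h2, h1, h2]; congr 1; ring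
        · rw [if_neg h2]; exact hfa _ (by omega)
      · rw [if_neg h1]; exact hfa _ (by omega)
    · rw [if_neg hk, map_zero]
      rw [if_neg (show ¬ b = k by omega), ite_self]
  have hG : truncLE q b hg.toLp = hg.toLp := by
    refine Lp_ext_fourierCoeff fun m => ?_
    rw [fourierCoeff_truncLE hp hq]
    split_ifs with hm
    · rfl
    · rw [fourierCoeff_congr hg.coeFn_toLp, hgb m (by omega)]
  have h1 := congrArg (fun T : LpT q →L[ℂ] ℂ => T hg.toLp) key
  simp only [ContinuousLinearMap.comp_apply, hG] at h1
  have h2 : fourierCoeff (fun x => f x * g x) n = pairing hfn.toLp hg.toLp := by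
    rw [pairing_apply, fourierCoeff]
    refine integral_congr_ae ?_
    filter_upwards [hfn.coeFn_toLp, hg.coeFn_toLp] with x e1 e2
    rw [e1, e2, smul_eq_mul, mul_assoc]
  rw [h2, h1]
  split_ifs
  · rw [smul_apply, coeffL_apply, smul_eq_mul, fourierCoeff_congr hg.coeFn_toLp]
  · rfl

theorem SpecLE.mul [hpq : p.HolderConjugate q] (hp : p ≠ ∞) (hq : q ≠ ∞)
    {f g : 𝕋 → ℂ} (hf : MemLp f p μ𝕋) (hg : MemLp g q μ𝕋) {a b : ℤ} (hfa : SpecLE f a)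
    (hgb : SpecLE g b) : SpecLE (fun x => f x * g x) (a + b) := fun n hn => by
  rw [fourierCoeff_mul_of_specLE hp hq hf hg hfa hgb hn.le, if_neg (by omega)]

end Product

/-- A nonzero function with spectrum bounded above has a leading Fourier coefficient. -/
theorem exists_leading {f : 𝕋 → ℂ} (hf : Integrable f μ𝕋) {a : ℤ} (hfa : SpecLE f a)
    (hne : ¬ f =ᵐ[μ𝕋] 0) : ∃ m ≤ a, SpecLE f m ∧ fourierCoeff f m ≠ 0 := by
  obtain ⟨n, hn⟩ : ∃ n, fourierCoeff f n ≠ 0 := by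
    by_contra! h
    exact hne (ae_eq_zero_of_fourierCoeff_eq_zero hf h)
  have hbd : ∀ m, fourierCoeff f m ≠ 0 → m ≤ a := fun m hm => by
    by_contra! h
    exact hm (hfa m h)
  obtain ⟨m, hm, hmax⟩ := Int.exists_greatest_of_bdd ⟨a, hbd⟩ ⟨n, hn⟩
  refine ⟨m, hbd m hm, fun k hk => ?_, hm⟩
  by_contra h
  exact absurd (hmax k h) (by omega)

/-! ### Reflection symmetries -/

theorem ae_comp_neg {P : 𝕋 → Prop} (h : ∀ᵐ x ∂μ𝕋, P x) : ∀ᵐ x ∂μ𝕋, P (-x) :=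
  (Measure.measurePreserving_neg μ𝕋).quasiMeasurePreserving.ae h

/-- The symmetry `k(t⁻¹) = -t^m k(t)` says that the Fourier coefficients are antisymmetric about
`-m / 2`. -/
theorem fourierCoeff_of_antisymm {k : 𝕋 → ℂ} {m : ℤ}
    (h : ∀ᵐ x ∂μ𝕋, k (-x) = -(fourier m x * k x)) (n : ℤ) :
    fourierCoeff k (-n) = -fourierCoeff k (n - m) := by
  rw [← fourierCoeff_comp_neg, ← fourierCoeff_fourier_mul, fourierCoeff_congr h, ← neg_one_mul,
    ← fourierCoeff.const_mul]
  simp only [neg_one_mul]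

/-- A function `k` with `k(t⁻¹) = -t² k(t)` and only negative frequencies vanishes: its Fourier
coefficients are antisymmetric about `-1`. -/
theorem ae_eq_zero_of_antisymm {k : 𝕋 → ℂ} (hk : Integrable k μ𝕋) (hs : SpecLE k (-1))
    (h : ∀ᵐ x ∂μ𝕋, k (-x) = -(fourier 2 x * k x)) : k =ᵐ[μ𝕋] 0 := by
  refine ae_eq_zero_of_fourierCoeff_eq_zero hk fun n => ?_
  rcases lt_trichotomy n (-1) with hn | hn | hn
  · have := fourierCoeff_of_antisymm h (-n)
    rw [neg_neg] at this
    rw [this, hs _ (by omega), neg_zero]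
  · have := fourierCoeff_of_antisymm h 1
    rw [show (1 : ℤ) - 2 = -1 by norm_num] at this
    rw [hn]
    exact self_eq_neg.mp this
  · exact hs n hn

instance : Nontrivial 𝕋 := by
  by_contra h
  rw [not_nontrivial_iff_subsingleton] at h
  have h1 : (fourier 1 : C(𝕋, ℂ)) = fourier 0 := by
    ext x
    rw [Subsingleton.elim x 0, fourier_eval_zero, fourier_eval_zero]
  have h2 := fourierCoeff_fourier_apply 1 1
  rw [h1, fourierCoeff_fourier_apply] at h2
  simp at h2

theorem ae_fourier_one_ne (c : ℂ) : ∀ᵐ x ∂μ𝕋, (fourier 1 x : ℂ) ≠ c := by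
  have hs : Set.Subsingleton {x : 𝕋 | (fourier 1 x : ℂ) = c} := by
    intro x hx y hy
    simp only [Set.mem_ofPred_eq, fourier_one] at hx hy
    exact injective_toCircle one_ne_zero (Circle.ext (hx.trans hy.symm))
  have h0 : μ𝕋 {x : 𝕋 | (fourier 1 x : ℂ) = c} = 0 := hs.measure_zero _
  rw [ae_iff]
  simpa using h0

theorem fourier_ne_zero (n : ℤ) (x : 𝕋) : (fourier n x : ℂ) ≠ 0 := fun h => by
  have := norm_fourier_apply n x
  rw [h, norm_zero] at this
  exact zero_ne_one this

theorem fourier_neg_one_eq_inv (x : 𝕋) : (fourier (-1) x : ℂ) = (fourier 1 x : ℂ)⁻¹ :=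
  eq_inv_of_mul_eq_one_left (fourier_neg_mul_fourier 1 x)

theorem ae_one_sub_ne_zero : ∀ᵐ x ∂μ𝕋, (1 - fourier (-1) x : ℂ) ≠ 0 := by
  filter_upwards [ae_fourier_one_ne 1] with x hx h
  rw [fourier_neg_one_eq_inv, sub_eq_zero, eq_comm, inv_eq_one] at h
  exact hx h

theorem ae_one_add_ne_zero : ∀ᵐ x ∂μ𝕋, (1 + fourier (-1) x : ℂ) ≠ 0 := by
  filter_upwards [ae_fourier_one_ne (-1)] with x hx h
  have h1 : (fourier (-1) x : ℂ) = -1 := by linear_combination h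
  have h2 := fourier_neg_mul_fourier 1 x
  rw [h1] at h2
  exact hx (by linear_combination -h2)

section Symmetrisation

variable {p q : ℝ≥0∞} [Fact (1 ≤ p)] [Fact (1 ≤ q)]

theorem coeFn_flipOp (f : LpT p) : flipOp p f =ᵐ[μ𝕋] fun x => fourier (-1) x * f (-x) := by
  have h1 : flipOp p f = mulOp p (fourierLp ∞ (-1)) (reflL p f) := rfl
  rw [h1]
  filter_upwards [coeFn_mulOp (fourierLp ∞ (-1)) (reflL p f), coeFn_fourierLp (T := 1) ∞ (-1),
    coeFn_reflL f] with x e1 e2 e3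
  rw [e1, e2, e3]

theorem fourierCoeff_flipOp (f : LpT p) (n : ℤ) :
    fourierCoeff (flipOp p f) n = fourierCoeff f (-1 - n) := by
  have h1 : flipOp p f = mulOp p (fourierLp ∞ (-1)) (reflL p f) := rfl
  rw [h1, fourierCoeff_mulOp_fourierLp, fourierCoeff_reflL]
  congr 1
  ring

/-- The operator `I + J` on `L^p`. -/
def symL (p : ℝ≥0∞) [Fact (1 ≤ p)] : LpT p →L[ℂ] LpT p := ContinuousLinearMap.id ℂ _ + flipOp p

theorem symL_apply (f : LpT p) : symL p f = f + flipOp p f := rfl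

theorem fourierCoeff_symL (f : LpT p) (n : ℤ) :
    fourierCoeff (symL p f) n = fourierCoeff f n + fourierCoeff f (-1 - n) := by
  rw [symL_apply, fourierCoeff_add_Lp, fourierCoeff_flipOp]

theorem symL_comp_neg (f : LpT p) : ∀ᵐ x ∂μ𝕋, symL p f (-x) = fourier 1 x * symL p f x := by
  have h : symL p f =ᵐ[μ𝕋] fun x => f x + fourier (-1) x * f (-x) := by
    rw [symL_apply]
    filter_upwards [Lp.coeFn_add f (flipOp p f), coeFn_flipOp f] with x e1 e2
    rw [e1, Pi.add_apply, e2]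
  filter_upwards [h, ae_comp_neg h] with x e1 e2
  rw [e1, e2, fourier_apply_neg, neg_neg, neg_neg]
  have := fourier_neg_mul_fourier 1 x
  linear_combination -f (-x) * this

/-- `I + J` maps `H^p` onto `L^p_J`, with inverse the Riesz projection. -/
theorem symL_rieszProjection [q.HolderConjugate p] (hp : p ≠ ∞) (hq : q ≠ ∞) (f : LpT p) :
    symL p (rieszProjection p (symL p f)) = symL p f := by
  refine Lp_ext_fourierCoeff fun n => ?_
  rw [fourierCoeff_symL, fourierCoeff_rieszProjection (q := q) hp hq,
    fourierCoeff_rieszProjection (q := q) hp hq, fourierCoeff_symL, fourierCoeff_symL,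
    show -1 - (-1 - n) = n by ring]
  split_ifs
  · omega
  · ring
  · ring
  · omega

theorem mem_LpJ_iff {f : LpT p} : f ∈ LpJ p ↔ ∃ g, symL p g = f := by
  constructor
  · rintro ⟨g, rfl⟩
    refine ⟨(2⁻¹ : ℂ) • g, ?_⟩
    rw [map_smul]
    rfl
  · rintro ⟨g, rfl⟩
    refine ⟨(2 : ℂ) • g, ?_⟩
    change (2⁻¹ : ℂ) • symL p ((2 : ℂ) • g) = _
    rw [map_smul, smul_smul, inv_mul_cancel₀ two_ne_zero, one_smul]

/-- `I + J` is injective on `H^p`, as `J` maps `H^p` into functions with negative frequencies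
only. -/
theorem eq_zero_of_symL_eq_zero {f : Hp p} (h : symL p f = 0) : f = 0 := by
  refine Subtype.ext (Lp_ext_fourierCoeff fun n => ?_)
  rw [Submodule.coe_zero, fourierCoeff_zero_Lp]
  rcases lt_or_ge n 0 with hn | hn
  · exact f.2 n hn
  · have h1 := fourierCoeff_symL (f : LpT p) n
    rw [h, fourierCoeff_zero_Lp, f.2 (-1 - n) (by omega), add_zero] at h1
    exact h1.symm

theorem toeplitzHankel_apply (φ : LpT ∞) (f : Hp p) :
    toeplitzHankel p φ f = rieszProjection p (mulOp p φ (symL p f)) := by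
  have : toeplitzHankel p φ f = rieszProjection p (mulOp p φ f)
      + rieszProjection p (mulOp p φ (flipOp p f)) := rfl
  rw [this, symL_apply, map_add, map_add]

theorem Hp_ext {f g : Hp p}
    (h : ∀ n : ℤ, 0 ≤ n → fourierCoeff (f : LpT p) n = fourierCoeff (g : LpT p) n) : f = g := by
  refine Subtype.ext (Lp_ext_fourierCoeff fun n => ?_)
  rcases lt_or_ge n 0 with hn | hn
  · rw [f.2 n hn, g.2 n hn]
  · exact h n hn

theorem fourierCoeff_toeplitzHankel [q.HolderConjugate p] (hp : p ≠ ∞) (hq : q ≠ ∞) (φ : LpT ∞)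
    (f : Hp p) {n : ℤ} (hn : 0 ≤ n) : fourierCoeff (toeplitzHankel p φ f : LpT p) n
      = fourierCoeff (mulOp p φ (symL p f)) n := by
  rw [toeplitzHankel_apply, fourierCoeff_rieszProjection (q := q) hp hq, if_pos hn]

/-- If `v ∈ L^q` annihilates `L^p_J`, then `v(t⁻¹) = -t⁻¹ v(t)`. -/
theorem comp_neg_of_annihilates [q.HolderConjugate p] (hp : p ≠ ∞) (hq : q ≠ ∞) {v : 𝕋 → ℂ}
    (hv : MemLp v q μ𝕋) (h : ∀ f : Hp p, ∫ x, v x * symL p f x ∂μ𝕋 = 0) :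
    ∀ᵐ x ∂μ𝕋, v (-x) = -(fourier (-1) x * v x) := by
  have hvi : Integrable v μ𝕋 := hv.integrable Fact.out
  have hcoef : ∀ n : ℤ, fourierCoeff v (-n) = -fourierCoeff v (n + 1) := fun n => by
    have h1 := h (rieszProjection p (symL p (fourierLp p n)))
    rw [symL_rieszProjection hp hq] at h1
    have h2 : symL p (fourierLp p n) = fourierLp p n + fourierLp p (-1 - n) := by
      refine Lp_ext_fourierCoeff fun m => ?_
      rw [fourierCoeff_symL, fourierCoeff_add_Lp, fourierCoeff_fourierLp, fourierCoeff_fourierLp,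
        fourierCoeff_fourierLp]
      congr 1
      split_ifs <;> first | rfl | omega
    rw [h2] at h1
    have h3 := map_add (pairing hv.toLp : LpT p →L[ℂ] ℂ) (fourierLp p n) (fourierLp p (-1 - n))
    rw [pairing_fourierLp, pairing_fourierLp, pairing_apply, fourierCoeff_congr hv.coeFn_toLp,
      fourierCoeff_congr hv.coeFn_toLp] at h3
    have h4 : ∫ x, hv.toLp v x * (fourierLp p n + fourierLp p (-1 - n) : LpT p) x ∂μ𝕋
        = ∫ x, v x * (fourierLp p n + fourierLp p (-1 - n) : LpT p) x ∂μ𝕋 := by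
      refine integral_congr_ae ?_
      filter_upwards [hv.coeFn_toLp] with x hx
      rw [hx]
    rw [h4, h1, show -(-1 - n) = n + 1 by ring] at h3
    linear_combination -h3
  have hvneg : Integrable (fun x => v (-x)) μ𝕋 :=
    (Measure.measurePreserving_neg μ𝕋).integrable_comp_of_integrable hvi
  refine ae_eq_of_fourierCoeff_eq hvneg (integrable_fourier_mul hvi (-1)).neg fun n => ?_
  have h5 : fourierCoeff (-fun x => fourier (-1) x * v x) n = -fourierCoeff v (n + 1) := by
    have h6 : (-fun x => fourier (-1) x * v x)
        = fun x : 𝕋 => (-1 : ℂ) * (fourier (-1) x * v x) := by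
      ext x
      simp
    rw [h6, fourierCoeff.const_mul, fourierCoeff_fourier_mul, sub_neg_eq_add, neg_one_mul]
  rw [fourierCoeff_comp_neg, hcoef]
  exact h5.symm

end Symmetrisation

/-! ### Chains of operators under a backward shift -/

section Shift

variable {H : Type*} [NormedAddCommGroup H] [NormedSpace ℂ H] {L S : H →L[ℂ] H}

/-- A right inverse of `L` inverts `L` up to the finite rank operator `S L - 1`, which maps into
`ker L`. -/
theorem isQuasiInverse_of_rightInverse (hLS : ∀ x, L (S x) = x) [FiniteDimensional ℂ L.ker] :
    (S : H →ₗ[ℂ] H).IsQuasiInverse (L : H →ₗ[ℂ] H) := by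
  constructor
  · refine LinearMap.FiniteRangeSetoid.equiv_iff_hasNoetherianRange.mpr ?_
    have hle : ((S : H →ₗ[ℂ] H) ∘ₗ (L : H →ₗ[ℂ] H) - .id).range ≤ L.ker := by
      rintro _ ⟨x, rfl⟩
      change L (S (L x) - x) = 0
      rw [map_sub, hLS, sub_self]
    exact isNoetherian_of_le hle
  · have : (L : H →ₗ[ℂ] H) ∘ₗ (S : H →ₗ[ℂ] H) = .id := LinearMap.ext hLS
    unfold LinearMap.IsRightQuasiInverse
    rw [this]

theorem isFredholm_comp_iff (hLS : ∀ x, L (S x) = x) [FiniteDimensional ℂ L.ker]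
    {A A' : H →L[ℂ] H} (hA : ∀ x, A' x = L (A x)) : A'.IsFredholm ↔ A.IsFredholm := by
  obtain rfl : A' = L ∘L A := ContinuousLinearMap.ext hA
  have hS := isQuasiInverse_of_rightInverse hLS
  constructor
  · intro h
    obtain ⟨v, hv⟩ := h.exists_isQuasiInverse
    exact .of_isQuasiInverse (v := v ∘L L) (hS.of_comp_right hv)
  · intro h
    obtain ⟨v, hv⟩ := h.exists_isQuasiInverse
    exact .of_isQuasiInverse (v := v ∘L S) (hv.comp hS)

theorem isFredholm_of_bijective [CompleteSpace H] {A : H →L[ℂ] H} (hA : Function.Bijective A) :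
    A.IsFredholm := by
  let e : H ≃L[ℂ] H := .ofBijective A (LinearMap.ker_eq_bot.mpr hA.1)
    (LinearMap.range_eq_top.mpr hA.2)
  exact .of_isQuasiInverse (v := (e.symm : H →L[ℂ] H)) e.toLinearEquiv.isQuasiInverse

/-- For surjective `L` with one-dimensional kernel, `ker L ^ k` has dimension `k`. -/
theorem rank_ker_pow (hL : Function.Surjective L) (hker : Module.finrank ℂ L.ker = 1) (k : ℕ) :
    Module.rank ℂ (L ^ k).ker = k := by
  have hfin : FiniteDimensional ℂ L.ker := Module.finite_of_finrank_pos (by omega)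
  induction k with
  | zero =>
    have : (L ^ 0).ker = ⊥ := LinearMap.ker_eq_bot.mpr fun x y h => h
    rw [this, rank_bot, Nat.cast_zero]
  | succ k ih =>
    have happ : ∀ x, (L ^ (k + 1)) x = (L ^ k) (L x) := fun x => by rw [pow_succ]; rfl
    let R : (L ^ (k + 1)).ker →ₗ[ℂ] (L ^ k).ker :=
      (L : H →ₗ[ℂ] H).restrict fun x (hx : (L ^ (k + 1)) x = 0) => by rwa [happ] at hx
    have hR : Function.Surjective R := by
      rintro ⟨y, hy⟩
      obtain ⟨x, rfl⟩ := hL y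
      exact ⟨⟨x, (happ x).trans hy⟩, rfl⟩
    have hle : L.ker ≤ (L ^ (k + 1)).ker := fun x (hx : L x = 0) => by
      change (L ^ (k + 1)) x = 0
      rw [happ, hx, map_zero]
    have hRk : R.ker = L.ker.comap (L ^ (k + 1)).ker.subtype := by
      ext x
      exact Subtype.ext_iff
    rw [LinearMap.rank_eq_of_surjective hR, ih, hRk,
      (Submodule.comapSubtypeEquivOfLe hle).rank_eq, ← Module.finrank_eq_rank, hker]
    push_cast
    ring

variable {A : ℤ → H →L[ℂ] H}

theorem chain_apply (hA : ∀ n x, A (n + 1) x = L (A n x)) (n : ℤ) (k : ℕ) (x : H) :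
    A (n + k) x = (L ^ k) (A n x) := by
  induction k with
  | zero => simp
  | succ k ih =>
    rw [Nat.cast_succ, ← add_assoc, hA, ih, pow_succ']
    rfl

theorem chain_isFredholm_iff (hLS : ∀ x, L (S x) = x) [FiniteDimensional ℂ L.ker]
    (hA : ∀ n x, A (n + 1) x = L (A n x)) (n : ℤ) : (A n).IsFredholm ↔ (A 0).IsFredholm := by
  induction n using Int.induction_on with
  | zero => rfl
  | succ n ih => rw [← ih]; exact isFredholm_comp_iff hLS (hA n)
  | pred n ih =>
    rw [← ih]
    refine (isFredholm_comp_iff hLS fun x => ?_).symm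
    rw [← hA, sub_add_cancel]

/-- If `A κ` is bijective with `κ ≤ 0`, then `A 0 = L ^ (-κ) ∘ A κ` is surjective and its kernel is
isomorphic to that of `L ^ (-κ)`. -/
theorem chain_ker_of_nonpos (hL : Function.Surjective L) (hker : Module.finrank ℂ L.ker = 1)
    (hA : ∀ n x, A (n + 1) x = L (A n x)) (k : ℕ) (hb : Function.Bijective (A (-k))) :
    Module.rank ℂ (A 0).ker = k ∧ (banachAdjoint (A 0)).ker = ⊥ := by
  have h0 : ∀ x, A 0 x = (L ^ k) (A (-k) x) := fun x => by
    rw [← chain_apply hA, neg_add_cancel]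
  constructor
  · let R : (A 0).ker →ₗ[ℂ] (L ^ k).ker :=
      (A (-k) : H →ₗ[ℂ] H).restrict fun x (hx : A 0 x = 0) => by rwa [h0] at hx
    have hR : Function.Bijective R := by
      refine ⟨fun x y h => Subtype.ext (hb.1 (congrArg Subtype.val h)), ?_⟩
      rintro ⟨y, hy⟩
      obtain ⟨x, rfl⟩ := hb.2 y
      exact ⟨⟨x, (h0 x).trans hy⟩, rfl⟩
    rw [(LinearEquiv.ofBijective R hR).rank_eq, rank_ker_pow hL hker]
  · have hs : Function.Surjective (L ^ k) := by
      rw [FunLike.coe_pow_eq_iterate]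
      exact hL.iterate k
    refine (Submodule.eq_bot_iff _).mpr fun ℓ hℓ => ?_
    ext y
    obtain ⟨z, rfl⟩ := hs y
    obtain ⟨x, rfl⟩ := hb.2 z
    rw [← h0]
    exact congrArg (fun T : StrongDual ℂ H => T x) hℓ

/-- If `A κ` is bijective with `κ ≥ 0`, then `A κ = L ^ κ ∘ A 0`, so that `A 0` is injective and its
range is a complement of `ker L ^ κ`. -/
theorem chain_ker_of_nonneg [CompleteSpace H] (hL : Function.Surjective L)
    (hker : Module.finrank ℂ L.ker = 1)
    (hA : ∀ n x, A (n + 1) x = L (A n x)) (k : ℕ) (hb : Function.Bijective (A k)) :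
    (A 0).ker = ⊥ ∧ Module.rank ℂ (banachAdjoint (A 0)).ker = k := by
  have h0 : ∀ x, A k x = (L ^ k) (A 0 x) := fun x => by
    rw [← chain_apply hA, zero_add]
  constructor
  · refine (Submodule.eq_bot_iff _).mpr fun x (hx : A 0 x = 0) => hb.1 ?_
    rw [h0, hx, map_zero, map_zero]
  · have hrk := rank_ker_pow hL hker k
    have hfd : FiniteDimensional ℂ (L ^ k).ker := Module.finite_of_rank_eq_nat hrk
    let e : H ≃L[ℂ] H := .ofBijective (A k) (LinearMap.ker_eq_bot.mpr hb.1)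
      (LinearMap.range_eq_top.mpr hb.2)
    have he : ∀ x, A k (e.symm x) = x := fun x => e.apply_symm_apply x
    have hproj : ∀ x, x - A 0 (e.symm ((L ^ k) x)) ∈ (L ^ k).ker := fun x => by
      change (L ^ k) _ = 0
      rw [map_sub, ← h0, he, sub_self]
    have hzero : ∀ ℓ : (banachAdjoint (A 0)).ker, ∀ x, (ℓ : StrongDual ℂ H) (A 0 x) = 0 :=
      fun ℓ x => congrArg (fun T : StrongDual ℂ H => T x) ℓ.2
    let R : (banachAdjoint (A 0)).ker →ₗ[ℂ] Module.Dual ℂ (L ^ k).ker :=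
      { toFun := fun ℓ => ((ℓ : StrongDual ℂ H) : H →ₗ[ℂ] ℂ) ∘ₗ (L ^ k).ker.subtype
        map_add' := fun _ _ => rfl
        map_smul' := fun _ _ => rfl }
    have hR : Function.Bijective R := by
      constructor
      · intro ℓ ℓ' hℓ
        refine Subtype.ext (ContinuousLinearMap.ext fun x => ?_)
        have h1 : (ℓ : StrongDual ℂ H) (x - A 0 (e.symm ((L ^ k) x)))
            = (ℓ' : StrongDual ℂ H) (x - A 0 (e.symm ((L ^ k) x))) :=
          congrArg (fun T => T ⟨_, hproj x⟩) hℓ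
        rwa [map_sub, map_sub, hzero, hzero, sub_zero, sub_zero] at h1
      · intro lam
        let pr : H →L[ℂ] (L ^ k).ker :=
          (ContinuousLinearMap.id ℂ H - A 0 ∘L (e.symm : H →L[ℂ] H) ∘L (L ^ k)).codRestrict _ hproj
        refine ⟨⟨LinearMap.toContinuousLinearMap lam ∘L pr, ?_⟩, ?_⟩
        · change (LinearMap.toContinuousLinearMap lam ∘L pr) ∘L A 0 = 0
          ext x
          have : pr (A 0 x) = 0 := Subtype.ext (by
            change A 0 x - A 0 (e.symm ((L ^ k) (A 0 x))) = 0
            rw [← h0, show e.symm (A k x) = x from e.symm_apply_apply x, sub_self])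
          rw [ContinuousLinearMap.comp_apply, ContinuousLinearMap.comp_apply, this, map_zero]
          rfl
        · ext x
          have : pr x = x := Subtype.ext (by
            change (x : H) - A 0 (e.symm ((L ^ k) (x : H))) = x
            rw [show (L ^ k) (x : H) = 0 from x.2, map_zero, map_zero, sub_zero])
          change lam (pr x) = lam x
          rw [this]
    have hfd' : FiniteDimensional ℂ (banachAdjoint (A 0)).ker :=
      Module.Finite.equiv (LinearEquiv.ofBijective R hR).symm
    rw [← Module.finrank_eq_rank, (LinearEquiv.ofBijective R hR).finrank_eq,
      Subspace.dual_finrank_eq, Module.finrank_eq_of_rank_eq hrk]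

/-- If `A 0` is Fredholm, the kernels of `A n` vanish for small `n` and are nonzero for large `n`.
For the least `N` with `ker (A N) ≠ 0` the operator `A N` is onto by `hcoburn`, and this makes
`A (N - 1)` bijective. -/
theorem exists_bijective_of_isFredholm [CompleteSpace H] (hLS : ∀ x, L (S x) = x)
    (hker : Module.finrank ℂ L.ker = 1) (hA : ∀ n x, A (n + 1) x = L (A n x))
    (hF : (A 0).IsFredholm) (hinter : ∀ x, (∀ n, A n x = 0) → x = 0)
    (hcoburn : ∀ n x (ℓ : StrongDual ℂ H), x ≠ 0 → A n x = 0 → (∀ y, ℓ (A n y) = 0) → ℓ = 0) :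
    ∃ κ, Function.Bijective (A κ) := by
  have hfd : FiniteDimensional ℂ L.ker := Module.finite_of_finrank_pos (by omega)
  have hL : Function.Surjective L := fun x => ⟨S x, hLS x⟩
  have hmono : ∀ n (k : ℕ) x, A n x = 0 → A (n + k) x = 0 := fun n k x hx => by
    rw [chain_apply hA, hx, map_zero]
  -- Some `A n` has a kernel: otherwise `ker L ^ n` embeds into the cokernel of `A 0` for all `n`.
  have hne : ∃ n, ∃ x, x ≠ 0 ∧ A n x = 0 := by
    have hco : FiniteDimensional ℂ (H ⧸ (A 0).range) :=
      hF.finite_coker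
    by_contra! h
    let n := Module.finrank ℂ (H ⧸ (A 0).range) + 1
    let R : (L ^ n).ker →ₗ[ℂ] H ⧸ (A 0).range := (A 0).range.mkQ ∘ₗ (L ^ n).ker.subtype
    have hR : Function.Injective R := by
      refine (injective_iff_map_eq_zero R).mpr fun x hx => Subtype.ext ?_
      obtain ⟨y, hy⟩ := (Submodule.Quotient.mk_eq_zero _).mp hx
      change A 0 y = x at hy
      have h1 : A n y = 0 := by
        have := chain_apply hA 0 n y
        rw [zero_add, hy] at this
        exact this.trans x.2
      have hy0 : y = 0 := by
        by_contra h2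
        exact h n y h2 h1
      rw [← hy, hy0, map_zero]
      rfl
    have h2 := LinearMap.finrank_le_finrank_of_injective hR
    rw [Module.finrank_eq_of_rank_eq (rank_ker_pow hL hker n)] at h2
    omega
  -- The finite dimensional kernels of `A (-k)` decrease to zero, hence vanish eventually.
  have hbdd : ∃ b : ℤ, ∀ n, (∃ x, x ≠ 0 ∧ A n x = 0) → b ≤ n := by
    have := hF.finite_ker
    let f : ℕ →o (Submodule ℂ (A 0).ker)ᵒᵈ :=
      { toFun := fun k => OrderDual.toDual ((A (-k)).ker.comap (A 0).ker.subtype)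
        monotone' := fun k m hkm => by
          obtain ⟨j, rfl⟩ := Nat.exists_eq_add_of_le hkm
          intro x (hx : A (-(k + j : ℕ)) x = 0)
          have := hmono _ j _ hx
          rw [show -((k + j : ℕ) : ℤ) + j = -k by push_cast; ring] at this
          exact this }
    obtain ⟨k, hk⟩ := IsArtinian.monotone_stabilizes f
    refine ⟨-k, fun n ⟨x, hx, hnx⟩ => ?_⟩
    by_contra! hn
    obtain ⟨j, hj⟩ := Int.eq_ofNat_of_zero_le (show 0 ≤ -k - n by omega)
    have hkx : A (-k) x = 0 := by
      have := hmono n j x hnx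
      rwa [← hj, show n + (-k - n) = -(k : ℤ) by ring] at this
    have h0x : A 0 x = 0 := by
      have := hmono _ k x hkx
      rwa [neg_add_cancel] at this
    refine hx (hinter x fun m => ?_)
    have hall : A (-(k + m.natAbs : ℕ)) x = 0 := by
      have h1 : (⟨x, h0x⟩ : (A 0).ker) ∈ OrderDual.ofDual (f k) := hkx
      rw [hk _ (Nat.le_add_right k m.natAbs)] at h1
      exact h1
    obtain ⟨i, hi⟩ := Int.eq_ofNat_of_zero_le (show 0 ≤ m - -(k + m.natAbs : ℕ) by omega)
    have := hmono _ i x hall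
    rwa [← hi, add_sub_cancel] at this
  obtain ⟨b, hb⟩ := hbdd
  obtain ⟨N, ⟨x, hx, hNx⟩, hmin⟩ := Int.exists_least_of_bdd ⟨b, hb⟩ hne
  have hsurj : Function.Surjective (A N) := by
    have hFN := (chain_isFredholm_iff hLS hA N).mpr hF
    have hcl : IsClosed ((A N).range : Set H) := hFN.isClosed_range
    intro y
    by_contra hy
    have hmk : (A N).range.mkQL y ≠ 0 := fun h => hy ((Submodule.Quotient.mk_eq_zero _).mp h)
    obtain ⟨g, hg⟩ := SeparatingDual.exists_ne_zero (R := ℂ) hmk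
    have h0 : g ∘L (A N).range.mkQL = 0 := hcoburn N x _ hx hNx fun z => by
      have : (A N).range.mkQL (A N z) = 0 := (Submodule.Quotient.mk_eq_zero _).mpr ⟨z, rfl⟩
      rw [ContinuousLinearMap.comp_apply, this, map_zero]
    exact hg (congrArg (fun T : StrongDual ℂ H => T y) h0)
  have hstep : ∀ z, A N z = L (A (N - 1) z) := fun z => by rw [← hA, sub_add_cancel]
  have hinj : ∀ z, A (N - 1) z = 0 → z = 0 := fun z hz => by
    by_contra h
    have := hmin (N - 1) ⟨z, h, hz⟩
    omega
  refine ⟨N - 1, (injective_iff_map_eq_zero _).mpr hinj, fun y => ?_⟩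
  -- The one-dimensional `ker L` lies in the range of `A (N - 1)`, as that maps `x` into it.
  obtain ⟨z, hz⟩ := hsurj (L y)
  have hk1 : L (A (N - 1) x) = 0 := by rw [← hstep, hNx]
  have hk2 : L (y - A (N - 1) z) = 0 := by rw [map_sub, ← hstep, hz, sub_self]
  obtain ⟨c, hc⟩ := (finrank_eq_one_iff_of_nonzero' (⟨_, hk1⟩ : L.ker) fun h =>
    hx (hinj x (congrArg Subtype.val h))).mp hker ⟨_, hk2⟩
  have hc' : c • A (N - 1) x = y - A (N - 1) z := congrArg Subtype.val hc
  exact ⟨z + c • x, by rw [map_add, map_smul, hc']; abel⟩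

end Shift

/-! ### A factorization with index zero gives an invertible operator -/

/-- A continuous linear map vanishing on `X₁` is constant along the monomials, hence zero by the
Riemann-Lebesgue lemma applied to the density representing a functional. -/
theorem clm_eq_zero_of_X₁ {p q : ℝ≥0∞} [Fact (1 ≤ p)] [Fact (1 ≤ q)] [q.HolderConjugate p]
    (hp : p ≠ ∞) (hq : q ≠ ∞) {E : Type*} [NormedAddCommGroup E] [NormedSpace ℂ E]
    (T : LpT p →L[ℂ] E) (h : ∀ f ∈ X₁, T (toLpT p f) = 0) : T = 0 := by
  have hstep : ∀ n : ℤ, T (fourierLp p n) = T (fourierLp p (n - 1)) := fun n => by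
    have h1 := h ((1 - fourier (-1)) * fourier n) ⟨_, Submodule.subset_span ⟨n, rfl⟩, rfl⟩
    have h2 : toLpT p ((1 - fourier (-1)) * fourier n) = fourierLp p n - fourierLp p (n - 1) := by
      rw [sub_mul, one_mul, map_sub]
      have : (fourier (-1) * fourier n : C(𝕋, ℂ)) = fourier (n - 1) := by
        ext x
        rw [ContinuousMap.mul_apply, fourier_mul_fourier, neg_add_eq_sub]
      rw [this]
    rwa [h2, map_sub, sub_eq_zero] at h1
  have hconst : ∀ n : ℤ, T (fourierLp p n) = T (fourierLp p 0) := fun n => by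
    induction n using Int.induction_on with
    | zero => rfl
    | succ n ih => rw [hstep, add_sub_cancel_right, ih]
    | pred n ih => rw [← hstep, ih]
  have hv : T (fourierLp p 0) = 0 := by
    by_contra hne
    obtain ⟨ℓ, hℓ⟩ := SeparatingDual.exists_ne_zero (R := ℂ) hne
    obtain ⟨g, hg⟩ := exists_pairing_eq (q := q) hp hq (ℓ ∘L T)
    have h1 : ∀ n : ℕ, fourierCoeff g n = ℓ (T (fourierLp p 0)) := fun n => by
      rw [← neg_neg (n : ℤ), ← pairing_fourierLp (p := p), hg, ContinuousLinearMap.comp_apply,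
        hconst]
    have h2 := tendsto_fourierCoeff_atTop hq g
    simp only [h1] at h2
    exact hℓ (tendsto_nhds_unique tendsto_const_nhds h2)
  exact clm_ext_fourierLp hp fun n => by rw [hconst, hv]; rfl

theorem IsInvertibleLinfty.ae_ne_zero {φ : LpT ∞} (h : IsInvertibleLinfty φ) :
    ∀ᵐ x ∂μ𝕋, φ x ≠ 0 := by
  obtain ⟨ψ, hψ⟩ := h
  filter_upwards [hψ] with x hx h0
  rw [h0, zero_mul] at hx
  exact zero_ne_one hx

theorem norm_one_sub_fourier_neg (x : 𝕋) :
    ‖1 - (fourier 1 (-x) : ℂ)‖ = ‖1 - (fourier 1 x : ℂ)‖ := by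
  have h : 1 - (fourier 1 (-x) : ℂ) = -(fourier (-1) x * (1 - fourier 1 x)) := by
    rw [fourier_apply_neg]
    linear_combination -fourier_neg_mul_fourier 1 x
  rw [h, norm_neg, norm_mul, norm_fourier_apply, one_mul]

theorem norm_one_add_fourier_neg (x : 𝕋) :
    ‖1 + (fourier 1 (-x) : ℂ)‖ = ‖1 + (fourier 1 x : ℂ)‖ := by
  have h : 1 + (fourier 1 (-x) : ℂ) = fourier (-1) x * (1 + fourier 1 x) := by
    rw [fourier_apply_neg]
    linear_combination -fourier_neg_mul_fourier 1 x
  rw [h, norm_mul, norm_fourier_apply, one_mul]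

/-- If the Fourier coefficients of `(1 + t⁻¹) z` of nonnegative order vanish, then so do those
of `z`: they alternate in sign and tend to zero. -/
theorem fourierCoeff_eq_zero_of_one_add_mul {p : ℝ≥0∞} [Fact (1 ≤ p)] (hp : p ≠ ∞) (z : LpT p)
    (h : SpecLE (fun x => (1 + fourier (-1) x) * z x) (-1)) {n : ℤ} (hn : 0 ≤ n) :
    fourierCoeff z n = 0 := by
  have hstep : ∀ n : ℤ, 0 ≤ n → fourierCoeff z (n + 1) = -fourierCoeff z n := fun n hn => by
    have h1 := h n (by omega)
    have h2 : (fun x => (1 + fourier (-1) x) * z x) = fun x => z x + fourier (-1) x * z x := by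
      ext x
      ring
    rw [h2, fourierCoeff_add' (integrable_Lp z) (integrable_fourier_mul (integrable_Lp z) _),
      fourierCoeff_fourier_mul, sub_neg_eq_add] at h1
    linear_combination h1
  obtain ⟨m, rfl⟩ := Int.eq_ofNat_of_zero_le hn
  have hnorm : ∀ k : ℕ, ‖fourierCoeff z (k + m : ℕ)‖ = ‖fourierCoeff z m‖ := fun k => by
    induction k with
    | zero => rw [zero_add]
    | succ k ih => rw [← ih, add_right_comm, Nat.cast_succ, hstep _ (by omega), norm_neg]
  have h2 := ((Filter.tendsto_add_atTop_iff_nat m).mpr (tendsto_fourierCoeff_atTop hp z)).norm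
  simp only [hnorm, norm_zero] at h2
  exact norm_eq_zero.mp (tendsto_nhds_unique tendsto_const_nhds h2)

section Sufficiency

variable {p q : ℝ≥0∞} [Fact (1 ≤ p)] [Fact (1 ≤ q)] [q.HolderConjugate p]
  {ψ : LpT ∞} {φm φ0 : 𝕋 → ℂ}

theorem rieszProjection_coe (hp : p ≠ ∞) (hq : q ≠ ∞) (f : Hp p) :
    rieszProjection p (f : LpT p) = f :=
  Hp_ext fun n hn => by rw [fourierCoeff_rieszProjection (q := q) hp hq, if_pos hn]

/-- For `f` in the kernel, with `F = f + J f` and `G = ψ F`, the function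
`(1 - t⁻¹) φ₋⁻¹ G = (1 - t⁻¹) φ₀ F` is antisymmetric about `-1` by its second form and has negative
spectrum by its first. -/
theorem injective_of_factorization (hp : p ≠ ∞) (hq : q ≠ ∞) (hψ : IsInvertibleLinfty ψ)
    (h : IsAsymmetricFactorization p q ψ φm 0 φ0) : Function.Injective (toeplitzHankel p ψ) := by
  refine (injective_iff_map_eq_zero _).mpr fun f hf => eq_zero_of_symL_eq_zero ?_
  set F := symL p (f : LpT p) with hF
  set G := mulOp p ψ F with hG
  have hGs : SpecLE G (-1) := fun n hn => by
    rw [hG, hF, ← fourierCoeff_toeplitzHankel (q := q) hp hq ψ f (by omega), hf]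
    exact fourierCoeff_zero_Lp p n
  obtain ⟨hm, hms⟩ := memConjHardy_iff.mp h.minus_inv_mem
  have hks := SpecLE.mul hq hp hm (Lp.memLp G) hms hGs
  have hki := integrable_mul_of_memLp hm (Lp.memLp G)
  have hk0 : (fun x => (1 - fourier (-1) x) * (φm x)⁻¹ * G x)
      =ᵐ[μ𝕋] fun x => (1 - fourier (-1) x) * (φ0 x * F x) := by
    filter_upwards [coeFn_mulOp ψ F, h.factorization, hψ.ae_ne_zero] with x h1 h2 h3
    rw [h1, h2]
    rw [h2] at h3
    have : φm x ≠ 0 := by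
      rintro h4
      simp [h4] at h3
    simp only [fourier_zero]
    field_simp
  have hsym : ∀ᵐ x ∂μ𝕋, (1 - fourier (-1) (-x)) * (φm (-x))⁻¹ * G (-x)
      = -(fourier 2 x * ((1 - fourier (-1) x) * (φm x)⁻¹ * G x)) := by
    filter_upwards [hk0, ae_comp_neg hk0, symL_comp_neg (f : LpT p), h.even_mem.2,
      ae_fourier_one_ne 1] with x h1 h2 h3 h4 h5
    rw [h1, h2, h3, fourier_apply_neg, neg_neg]
    rw [norm_one_sub_fourier_neg] at h4
    have h6 : φ0 (-x) = φ0 x := by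
      refine mul_left_cancel₀ ?_ h4
      rw [Complex.ofReal_ne_zero, norm_ne_zero_iff, sub_ne_zero]
      exact h5.symm
    have h7 : (fourier 2 x : ℂ) = fourier 1 x * fourier 1 x := by
      rw [fourier_mul_fourier]; rfl
    rw [h6, h7]
    linear_combination -fourier 1 x * φ0 x * F x * fourier_neg_mul_fourier 1 x
  have hk := ae_eq_zero_of_antisymm hki (by simpa using hks) hsym
  refine Lp.ext ?_
  filter_upwards [hk, hk0, ae_one_sub_ne_zero, hψ.ae_ne_zero, h.factorization,
    Lp.coeFn_zero ℂ p μ𝕋] with x h1 h2 h3 h4 h5 h6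
  rw [h6]
  rw [h2] at h1
  rcases mul_eq_zero.mp h1 with h7 | h7
  · exact absurd h7 h3
  · refine (mul_eq_zero.mp h7).resolve_left fun h8 => h4 ?_
    rw [h5, h8, mul_zero]

variable [p.HolderConjugate q]

/-- For `f ∈ X₁` and `Y = B f` the difference `ψ Y - f` equals `φ₋ ((I + J) P - I) (φ₋⁻¹ f)`, which
has only negative frequencies. -/
theorem rieszProjection_mul_extension (hp : p ≠ ∞) (hq : q ≠ ∞) (hψ : IsInvertibleLinfty ψ)
    (h : IsAsymmetricFactorization p q ψ φm 0 φ0) {f : C(𝕋, ℂ)}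
    (hf : MemLp (fun x => (φm x)⁻¹ * f x) q μ𝕋) {Y : LpT p} (hY : Y =ᵐ[μ𝕋] opB q φm φ0 f hf) :
    rieszProjection p (mulOp p ψ Y - toLpT p f) = 0 := by
  refine Hp_ext fun n hn => ?_
  rw [fourierCoeff_rieszProjection (q := q) hp hq, if_pos hn, Submodule.coe_zero,
    fourierCoeff_zero_Lp]
  refine fourierCoeff_eq_zero_of_one_add_mul hp _ ?_ hn
  set v : LpT q := hf.toLp
  set w : LpT q := symL q (rieszProjection q v) - v with hw
  obtain ⟨hm, hms⟩ := memConjHardy_iff.mp h.minus_mem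
  have hws : SpecLE w (-1) := fun k hk => by
    rw [hw, fourierCoeff_sub_Lp, fourierCoeff_symL, fourierCoeff_rieszProjection (q := p) hq hp,
      fourierCoeff_rieszProjection (q := p) hq hp, if_pos (by omega), if_neg (by omega), add_zero,
      sub_self]
  have hprod := SpecLE.mul hp hq hm (Lp.memLp w) hms hws
  rw [zero_add] at hprod
  refine hprod.congr ?_
  filter_upwards [Lp.coeFn_sub (mulOp p ψ Y) (toLpT p f), coeFn_mulOp ψ Y, coeFn_toLpT (p := p) f,
    hY, h.factorization, hψ.ae_ne_zero, Lp.coeFn_sub (symL q (rieszProjection q v)) v,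
    hf.coeFn_toLp] with x h1 h2 h3 h4 h5 h6 h7 h8
  have hB : opB q φm φ0 f hf x = (φ0 x)⁻¹ * symL q (rieszProjection q v) x := rfl
  rw [h1, hw, h7, Pi.sub_apply, Pi.sub_apply, h2, h3, h4, hB, h8, h5]
  rw [h5] at h6
  have h9 : φm x ≠ 0 := fun h9 => by simp [h9] at h6
  have h10 : φ0 x ≠ 0 := fun h10 => by simp [h10] at h6
  simp only [fourier_zero]
  field_simp

/-- The operator `P B` is a right inverse of `M(ψ)`: the identity `P (ψ B f) = P f` holds on `X₁`,
hence on `L^p`. -/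
theorem bijective_of_factorization (hp : p ≠ ∞) (hq : q ≠ ∞) (hψ : IsInvertibleLinfty ψ)
    (h : IsAsymmetricFactorization p q ψ φm 0 φ0) : Function.Bijective (toeplitzHankel p ψ) := by
  refine ⟨injective_of_factorization hp hq hψ h, fun f => ?_⟩
  obtain ⟨Bext, hB⟩ := h.bounded_extension
  have hT : rieszProjection p ∘L (mulOp p ψ ∘L (LpJ p).subtypeL ∘L Bext
      - ContinuousLinearMap.id ℂ (LpT p)) = 0 := by
    refine clm_eq_zero_of_X₁ (q := q) hp hq _ fun g hg => ?_
    obtain ⟨hg', hY⟩ := hB g hg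
    exact rieszProjection_mul_extension hp hq hψ h hg' hY
  have h1 : rieszProjection p (mulOp p ψ (Bext f : LpT p) - f) = 0 :=
    congrArg (fun T : LpT p →L[ℂ] Hp p => T f) hT
  rw [map_sub, sub_eq_zero, rieszProjection_coe (q := q) hp hq] at h1
  obtain ⟨g, hg⟩ := mem_LpJ_iff.mp (Bext f).2
  refine ⟨rieszProjection p (symL p g), ?_⟩
  rw [toeplitzHankel_apply, symL_rieszProjection (q := q) hp hq, hg, h1]

end Sufficiency

/-! ### An invertible operator yields a factorization with index zero -/

theorem isClosed_Hp (p : ℝ≥0∞) [Fact (1 ≤ p)] : IsClosed (Hp p : Set (LpT p)) := by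
  have : (Hp p : Set (LpT p)) = ⋂ n : ℤ, ⋂ _ : n < 0, {f | coeffL p n f = 0} := by
    ext f
    simp only [Set.mem_iInter]
    rfl
  rw [this]
  exact isClosed_iInter fun n => isClosed_iInter fun _ =>
    isClosed_eq (coeffL p n).continuous continuous_const

instance (p : ℝ≥0∞) [Fact (1 ≤ p)] : CompleteSpace (Hp p) := (isClosed_Hp p).completeSpace_coe

theorem exists_inverse_of_bijective {H : Type*} [NormedAddCommGroup H] [NormedSpace ℂ H]
    [CompleteSpace H] {A : H →L[ℂ] H} (hA : Function.Bijective A) :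
    ∃ B : H →L[ℂ] H, (∀ x, A (B x) = x) ∧ ∀ x, B (A x) = x := by
  let e : H ≃L[ℂ] H := .ofBijective A (LinearMap.ker_eq_bot.mpr hA.1)
    (LinearMap.range_eq_top.mpr hA.2)
  exact ⟨e.symm, fun x => e.apply_symm_apply x, fun x => e.symm_apply_apply x⟩

theorem fourier_two (x : 𝕋) : (fourier 2 x : ℂ) = fourier 1 x * fourier 1 x := by
  rw [fourier_mul_fourier]; rfl

section Necessity

variable {p q : ℝ≥0∞} [Fact (1 ≤ p)] [Fact (1 ≤ q)] [q.HolderConjugate p] {ψ : LpT ∞}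

/-- For `F` the solution of `P(ψ F) = 1` in `L^p_J`, there is a cofactor `h = 1 + t⁻¹ h₁` of
`G = ψ F` with `h G = 1 - t⁻²`: the function `t + h₁` represents the functional which to `X`
assigns the coefficient of order `-1` of `X - ψ Y`, where `Y ∈ L^p_J` solves `P(ψ Y) = P X`. This
functional kills `ψ L^p_J`, which gives `h G` a symmetry that, combined with the one-sided spectra
of `h` and `G`, leaves two coefficients only. -/
theorem exists_cofactor (hp : p ≠ ∞) (hq : q ≠ ∞) {B : Hp p →L[ℂ] Hp p}
    (hAB : ∀ x, toeplitzHankel p ψ (B x) = x) (hBA : ∀ x, B (toeplitzHankel p ψ x) = x) :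
    ∃ (f : Hp p) (h : LpT q), SpecLE (mulOp p ψ (symL p f)) 0 ∧ SpecLE h 0 ∧
      ∀ᵐ x ∂μ𝕋, h x * mulOp p ψ (symL p f) x = (1 - fourier (-1) x) * (1 + fourier (-1) x) := by
  set f : Hp p := B (rieszProjection p (fourierLp p 0)) with hf
  set F := symL p (f : LpT p) with hF
  set G := mulOp p ψ F with hG
  have hGn : ∀ n : ℤ, 0 ≤ n → fourierCoeff G n = if n = 0 then 1 else 0 := fun n hn => by
    rw [hG, hF, ← fourierCoeff_toeplitzHankel (q := q) hp hq ψ f hn, hf, hAB,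
      fourierCoeff_rieszProjection (q := q) hp hq, if_pos hn, fourierCoeff_fourierLp]
  have hGs : SpecLE G 0 := fun n hn => by rw [hGn n hn.le, if_neg hn.ne']
  let Λ : LpT p →L[ℂ] ℂ := -(coeffL p (-1) ∘L mulOp p ψ ∘L symL p ∘L (Hp p).subtypeL ∘L B ∘L
    rieszProjection p)
  have hΛ : ∀ X, Λ X = -fourierCoeff (mulOp p ψ (symL p (B (rieszProjection p X) : LpT p))) (-1) :=
    fun X => rfl
  obtain ⟨h₁, hh₁⟩ := exists_pairing_eq (q := q) hp hq Λ
  have hh₁s : ∀ n : ℤ, 0 < n → fourierCoeff h₁ n = 0 := fun n hn => by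
    have h0 : rieszProjection p (fourierLp p (-n)) = 0 := Hp_ext fun m hm => by
      rw [fourierCoeff_rieszProjection (q := q) hp hq, if_pos hm, fourierCoeff_fourierLp,
        if_neg (by omega), Submodule.coe_zero, fourierCoeff_zero_Lp]
    rw [← neg_neg n, ← pairing_fourierLp (p := p), hh₁, hΛ, h0, map_zero, Submodule.coe_zero,
      map_zero, map_zero, fourierCoeff_zero_Lp, neg_zero]
  set h : LpT q := fourierLp q 0 + mulOp q (fourierLp ∞ (-1)) h₁ with hh
  have hhn : ∀ n, fourierCoeff h n = (if n = 0 then 1 else 0) + fourierCoeff h₁ (n + 1) :=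
    fun n => by
      rw [hh, fourierCoeff_add_Lp, fourierCoeff_fourierLp, fourierCoeff_mulOp_fourierLp,
        sub_neg_eq_add]
  have hhs : SpecLE h 0 := fun n hn => by
    rw [hhn, if_neg hn.ne', hh₁s _ (by omega), add_zero]
  have hhx : ∀ᵐ x ∂μ𝕋, fourier 1 x * h x = fourier 1 x + h₁ x := by
    filter_upwards [Lp.coeFn_add (fourierLp q 0) (mulOp q (fourierLp ∞ (-1)) h₁),
      coeFn_fourierLp (T := 1) q 0, coeFn_mulOp (fourierLp ∞ (-1)) h₁,
      coeFn_fourierLp (T := 1) ∞ (-1)] with x e1 e2 e3 e4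
    rw [hh, e1, Pi.add_apply, e2, e3, e4, fourier_zero]
    linear_combination h₁ x * fourier_neg_mul_fourier 1 x
  have hv : MemLp (fun x => fourier 1 x * mulOp q ψ h x) q μ𝕋 := memLp_fourier_mul (Lp.memLp _) 1
  have hann : ∀ g : Hp p, ∫ x, fourier 1 x * mulOp q ψ h x * symL p g x ∂μ𝕋 = 0 := fun g => by
    set X := mulOp p ψ (symL p (g : LpT p)) with hX
    have h1 : ∫ x, fourier 1 x * mulOp q ψ h x * symL p g x ∂μ𝕋
        = ∫ x, (fourier 1 x * X x + h₁ x * X x) ∂μ𝕋 := by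
      refine integral_congr_ae ?_
      filter_upwards [coeFn_mulOp ψ h, coeFn_mulOp ψ (symL p (g : LpT p)), hhx] with x e1 e2 e3
      rw [hX, e1, e2]
      linear_combination ψ x * symL p g x * e3
    have h2 : ∫ x, fourier 1 x * X x ∂μ𝕋 = fourierCoeff X (-1) := by
      rw [fourierCoeff, neg_neg]
      rfl
    have h3 : ∫ x, h₁ x * X x ∂μ𝕋 = -fourierCoeff X (-1) := by
      rw [← pairing_apply, hh₁, hΛ, hX, ← toeplitzHankel_apply, hBA]
    rw [h1, integral_add (integrable_fourier_mul (integrable_Lp X) 1)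
      (integrable_mul_of_memLp (Lp.memLp h₁) (Lp.memLp X)), h2, h3, add_neg_cancel]
  have hvsym := comp_neg_of_annihilates hp hq hv hann
  refine ⟨f, h, hGs, hhs, ?_⟩
  have hkF : ∀ᵐ x ∂μ𝕋, h x * G x = fourier (-1) x * (fourier 1 x * mulOp q ψ h x) * F x := by
    filter_upwards [coeFn_mulOp ψ h, coeFn_mulOp ψ F] with x e1 e2
    rw [hG, e1, e2]
    linear_combination -ψ x * h x * F x * fourier_neg_mul_fourier 1 x
  have hksym : ∀ᵐ x ∂μ𝕋, h (-x) * G (-x) = -(fourier 2 x * (h x * G x)) := by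
    filter_upwards [hkF, ae_comp_neg hkF, hvsym, symL_comp_neg (f : LpT p)] with x e1 e2 e3 e4
    rw [e1, e2, e3, e4, fourier_apply_neg, neg_neg, fourier_two]
    ring
  have hki : Integrable (fun x => h x * G x) μ𝕋 := integrable_mul_of_memLp (Lp.memLp h) (Lp.memLp G)
  have hkn : ∀ n : ℤ, 0 ≤ n → fourierCoeff (fun x => h x * G x) n = if n = 0 then 1 else 0 :=
    fun n hn => by
      rw [fourierCoeff_mul_of_specLE hq hp (Lp.memLp h) (Lp.memLp G) hhs hGs (by simpa using hn),
        hhn, hh₁s _ (by omega), hGn 0 le_rfl]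
      simp
  have hki' : Integrable (fun x : 𝕋 => (fourier 0 x - fourier (-2) x : ℂ)) μ𝕋 :=
    (integrable_continuousMap (fourier 0)).sub (integrable_continuousMap (fourier (-2)))
  have hfin := ae_eq_of_fourierCoeff_eq hki hki' fun n => by
    rw [fourierCoeff_sub' (integrable_continuousMap (fourier 0))
      (integrable_continuousMap (fourier (-2))), fourierCoeff_fourier_apply,
      fourierCoeff_fourier_apply]
    have hs := fourierCoeff_of_antisymm (k := fun x => h x * G x) hksym (-n)
    rw [neg_neg] at hs
    rcases le_or_gt 0 n with hn | hn
    · rw [hkn n hn, if_neg (show ¬ n = -2 by omega), sub_zero]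
    · rw [if_neg (show ¬ n = 0 by omega), zero_sub]
      rcases eq_or_ne n (-1) with rfl | hn1
      · rw [if_neg (by norm_num), neg_zero]
        rw [show -(-1 : ℤ) - 2 = -1 by norm_num] at hs
        exact self_eq_neg.mp hs
      · rw [hs, hkn _ (by omega)]
        congr 1
        split_ifs <;> first | rfl | omega
  filter_upwards [hfin] with x hx
  have h2 : (fourier (-2) x : ℂ) = fourier (-1) x * fourier (-1) x := by
    rw [fourier_mul_fourier]; rfl
  rw [hx, fourier_zero, h2]
  ring

end Necessity

theorem memLp_mul_continuous {q : ℝ≥0∞} {f : 𝕋 → ℂ} (hf : MemLp f q μ𝕋) (r : C(𝕋, ℂ)) :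
    MemLp (fun x => f x * r x) q μ𝕋 :=
  hf.of_le_mul (c := ‖r‖) (hf.1.mul r.continuous.aestronglyMeasurable)
    (Filter.Eventually.of_forall fun x => by
      rw [norm_mul, mul_comm]
      exact mul_le_mul_of_nonneg_right (r.norm_coe_le_norm x) (norm_nonneg _))

section Necessity

variable {p q : ℝ≥0∞} [Fact (1 ≤ p)] [Fact (1 ≤ q)] [q.HolderConjugate p] {ψ : LpT ∞}

/-- The identity `φ₀ B' f = (I + J) P (φ₋⁻¹ f)` for `B' = (I + J) M(ψ)⁻¹ P`, in the form of a
statement on `Y = B' f` and `w = φ₋⁻¹ f`. After multiplication by `1 - t⁻¹` the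
difference `k` of the two sides is antisymmetric, and it equals
`h (ψ Y - f) + (1 - t⁻¹) (w - (I + J) P w)`, so that its spectrum is negative. -/
theorem mul_eq_symL_rieszProjection [p.HolderConjugate q] (hp : p ≠ ∞) (hq : q ≠ ∞)
    {φ0 : 𝕋 → ℂ} {h w : LpT q} {f Y : LpT p} (hhs : SpecLE h 0)
    (heven : ∀ᵐ x ∂μ𝕋, φ0 (-x) = φ0 x)
    (hh : ∀ᵐ x ∂μ𝕋, (1 - fourier (-1) x) * φ0 x = h x * ψ x)
    (hw : ∀ᵐ x ∂μ𝕋, h x * f x = (1 - fourier (-1) x) * w x)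
    (hY : ∀ᵐ x ∂μ𝕋, Y (-x) = fourier 1 x * Y x)
    (hYf : SpecLE (mulOp p ψ Y - f : LpT p) (-1)) :
    ∀ᵐ x ∂μ𝕋, φ0 x * Y x = symL q (rieszProjection q w) x := by
  set V := symL q (rieszProjection q w : LpT q) with hV
  set d : LpT q := w - V with hd
  have hds : SpecLE d (-1) := fun n hn => by
    rw [hd, fourierCoeff_sub_Lp, hV, fourierCoeff_symL,
      fourierCoeff_rieszProjection (q := p) hq hp, fourierCoeff_rieszProjection (q := p) hq hp,
      if_pos (by omega), if_neg (by omega), add_zero, sub_self]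
  set g : LpT p := mulOp p ψ Y - f with hg
  have hsum : ∀ᵐ x ∂μ𝕋, h x * g x + (d x - fourier (-1) x * d x)
      = (1 - fourier (-1) x) * (φ0 x * Y x - V x) := by
    filter_upwards [Lp.coeFn_sub (mulOp p ψ Y) f, coeFn_mulOp ψ Y, Lp.coeFn_sub w V, hh, hw]
      with x e1 e2 e3 e4 e5
    rw [hg, e1, hd, e3, Pi.sub_apply, Pi.sub_apply, e2]
    linear_combination -Y x * e4 - e5
  have hi1 : Integrable (fun x => h x * g x) μ𝕋 := integrable_mul_of_memLp (Lp.memLp h) (Lp.memLp g)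
  have hi2 : Integrable (fun x => fourier (-1) x * d x) μ𝕋 :=
    integrable_fourier_mul (integrable_Lp d) _
  have hi3 : Integrable (fun x => d x - fourier (-1) x * d x) μ𝕋 := (integrable_Lp d).sub hi2
  have hs1 : SpecLE (fun x => h x * g x) (-1) := by
    have := SpecLE.mul hq hp (Lp.memLp h) (Lp.memLp g) hhs hYf
    rwa [zero_add] at this
  have hks : SpecLE (fun x => h x * g x + (d x - fourier (-1) x * d x)) (-1) := fun n hn => by
    rw [fourierCoeff_add' hi1 hi3, fourierCoeff_sub' (integrable_Lp d) hi2,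
      fourierCoeff_fourier_mul, hs1 n hn, hds n hn, hds _ (by omega)]
    ring
  have hk := ae_eq_zero_of_antisymm (hi1.add hi3) hks (by
    filter_upwards [hsum, ae_comp_neg hsum, heven, hY, symL_comp_neg (rieszProjection q w : LpT q)]
      with x e1 e2 e3 e4 e5
    simp only [Pi.add_apply]
    rw [e1, e2, e3, e4, e5, fourier_apply_neg, neg_neg, fourier_two]
    linear_combination -fourier 1 x * (φ0 x * Y x - V x) * fourier_neg_mul_fourier 1 x)
  filter_upwards [hk, hsum, ae_one_sub_ne_zero] with x e1 e2 e3
  have e1' : h x * g x + (d x - fourier (-1) x * d x) = 0 := e1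
  rw [e2] at e1'
  exact sub_eq_zero.mp ((mul_eq_zero.mp e1').resolve_left e3)

/-- With the functions `F`, `G = ψ F` and `h` of `exists_cofactor`, the factors are
`φ₋ = G / (1 + t⁻¹)` and `φ₀ = (1 + t⁻¹) / F`; then `(1 - t⁻¹) φ₋⁻¹ = h` and
`(1 - t⁻¹) φ₀ = h ψ`. -/
theorem exists_factorization_of_bijective [p.HolderConjugate q] (hp : p ≠ ∞) (hq : q ≠ ∞)
    (hA : Function.Bijective (toeplitzHankel p ψ)) :
    ∃ φm φ0 : 𝕋 → ℂ, IsAsymmetricFactorization p q ψ φm 0 φ0 := by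
  obtain ⟨B, hAB, hBA⟩ := exists_inverse_of_bijective hA
  obtain ⟨f, h, hGs, hhs, hhG⟩ := exists_cofactor (q := q) hp hq hAB hBA
  set F := symL p (f : LpT p) with hF
  set G := mulOp p ψ F with hG
  have hF0 : ∀ᵐ x ∂μ𝕋, F x ≠ 0 := by
    filter_upwards [hhG, coeFn_mulOp ψ F, ae_one_sub_ne_zero, ae_one_add_ne_zero]
      with x e1 e2 e3 e4 e5
    rw [hG, e2, e5, mul_zero, mul_zero] at e1
    exact mul_ne_zero e3 e4 e1.symm
  have hG0 : ∀ᵐ x ∂μ𝕋, G x ≠ 0 := by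
    filter_upwards [hhG, ae_one_sub_ne_zero, ae_one_add_ne_zero] with x e1 e3 e4 e5
    rw [e5, mul_zero] at e1
    exact mul_ne_zero e3 e4 e1.symm
  let φm : 𝕋 → ℂ := fun x => G x * (1 + fourier (-1) x)⁻¹
  let φ0 : 𝕋 → ℂ := fun x => (1 + fourier (-1) x) * (F x)⁻¹
  have hinv : ∀ᵐ x ∂μ𝕋, (1 - fourier (-1) x) * (φm x)⁻¹ = h x := by
    filter_upwards [hhG, hG0] with x e1 e2
    simp only [φm, mul_inv, inv_inv]
    rw [← mul_left_inj' e2, e1]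
    field_simp
  have hφ0 : ∀ᵐ x ∂μ𝕋, (1 - fourier (-1) x) * φ0 x = h x * ψ x := by
    filter_upwards [hhG, hF0, coeFn_mulOp ψ F] with x e1 e2 e3
    rw [hG, e3] at e1
    simp only [φ0]
    rw [← mul_left_inj' e2, mul_assoc (h x), e1]
    field_simp
  have heven : ∀ᵐ x ∂μ𝕋, φ0 (-x) = φ0 x := by
    filter_upwards [symL_comp_neg (f : LpT p), hF0] with x e1 e2
    have e3 : F (-x) = fourier 1 x * F x := e1
    have e4 := fourier_ne_zero 1 x
    simp only [φ0]
    rw [e3, fourier_apply_neg, neg_neg, fourier_neg_one_eq_inv]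
    field_simp
    ring
  have hmeas0 : AEStronglyMeasurable φ0 μ𝕋 := by
    have hc : Continuous fun x : 𝕋 => (1 + fourier (-1) x : ℂ) := by fun_prop
    have hFi : AEStronglyMeasurable (fun x => (F x)⁻¹) μ𝕋 :=
      (Lp.aestronglyMeasurable F).aemeasurable.inv.aestronglyMeasurable
    exact hc.aestronglyMeasurable.mul hFi
  have hnorm_sub : ∀ x : 𝕋, ‖1 - (fourier 1 x : ℂ)‖ = ‖1 - (fourier (-1) x : ℂ)‖ := fun x => by
    rw [← norm_one_sub_fourier_neg, fourier_apply_neg]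
  have hnorm_add : ∀ x : 𝕋, ‖1 + (fourier 1 x : ℂ)‖ = ‖1 + (fourier (-1) x : ℂ)‖ := fun x => by
    rw [← norm_one_add_fourier_neg, fourier_apply_neg]
  refine ⟨φm, φ0, ?_, ?_, ?_, ⟨?_, ?_⟩, ⟨?_, ?_⟩, ?_⟩
  · filter_upwards [hF0, coeFn_mulOp ψ F, ae_one_add_ne_zero] with x e1 e2 e3
    simp only [φm, φ0]
    rw [hG, e2, fourier_zero]
    field_simp
  · have : (G : 𝕋 → ℂ) =ᵐ[μ𝕋] fun x => (1 + fourier (-1) x) * φm x := by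
      filter_upwards [ae_one_add_ne_zero] with x e1
      simp only [φm]
      field_simp
    exact memConjHardy_iff.mpr ⟨(Lp.memLp G).ae_eq this, hGs.congr this⟩
  · have : (h : 𝕋 → ℂ) =ᵐ[μ𝕋] fun x => (1 - fourier (-1) x) * (φm x)⁻¹ := by
      filter_upwards [hinv] with x e1
      rw [e1]
    exact memConjHardy_iff.mpr ⟨(Lp.memLp h).ae_eq this, hhs.congr this⟩
  · refine (Lp.memLp (mulOp q ψ h)).of_le ((by fun_prop :
      Continuous fun x : 𝕋 => (‖1 - (fourier 1 x : ℂ)‖ : ℂ)).aestronglyMeasurable.mul hmeas0) ?_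
    filter_upwards [hφ0, coeFn_mulOp ψ h] with x e1 e2
    rw [e2, mul_comm (ψ x), ← e1, norm_mul, norm_mul (1 - _) (φ0 x), Complex.norm_real,
      norm_norm, hnorm_sub]
  · filter_upwards [heven] with x e1
    rw [norm_one_sub_fourier_neg, e1]
  · refine (Lp.memLp F).of_le ((by fun_prop :
      Continuous fun x : 𝕋 => (‖1 + (fourier 1 x : ℂ)‖ : ℂ)).aestronglyMeasurable.mul
        hmeas0.aemeasurable.inv.aestronglyMeasurable) ?_
    filter_upwards [ae_one_add_ne_zero] with x e1
    have e2 := norm_ne_zero_iff.mpr e1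
    simp only [φ0]
    rw [norm_mul, Complex.norm_real, norm_norm, hnorm_add, norm_inv, norm_mul, norm_inv, mul_inv,
      inv_inv, mul_inv_cancel_left₀ e2]
  · filter_upwards [heven] with x e1
    rw [norm_one_add_fourier_neg, e1]
  · let T : LpT p →L[ℂ] LpT p := symL p ∘L (Hp p).subtypeL ∘L B ∘L rieszProjection p
    refine ⟨T.codRestrict (LpJ p) fun g => mem_LpJ_iff.mpr ⟨_, rfl⟩, ?_⟩
    rintro g ⟨r, -, rfl⟩
    have hw : MemLp (fun x => (φm x)⁻¹ * ((1 - fourier (-1)) * r : C(𝕋, ℂ)) x) q μ𝕋 := by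
      refine (memLp_mul_continuous (Lp.memLp h) r).ae_eq ?_
      filter_upwards [hinv] with x e1
      rw [← e1]
      simp only [ContinuousMap.mul_apply, ContinuousMap.sub_apply, ContinuousMap.one_apply]
      ring
    refine ⟨hw, ?_⟩
    set g : C(𝕋, ℂ) := (1 - fourier (-1)) * r
    have hYf : SpecLE (mulOp p ψ (T (toLpT p g)) - toLpT p g : LpT p) (-1) := fun n hn => by
      have e1 : toeplitzHankel p ψ (B (rieszProjection p (toLpT p g)))
          = rieszProjection p (toLpT p g) := hAB _
      have e2 := fourierCoeff_toeplitzHankel (q := q) hp hq ψ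
        (B (rieszProjection p (toLpT p g))) (show 0 ≤ n by omega)
      rw [e1, fourierCoeff_rieszProjection (q := q) hp hq, if_pos (by omega)] at e2
      rw [fourierCoeff_sub_Lp, e2]
      exact sub_self _
    let w : LpT q := hw.toLp
    have hwx : ∀ᵐ x ∂μ𝕋, h x * toLpT p g x = (1 - fourier (-1) x) * w x := by
      filter_upwards [hinv, hw.coeFn_toLp, coeFn_toLpT (p := p) g] with x e1 e2 e3
      rw [e2, e3, ← e1]
      ring
    have hfin := mul_eq_symL_rieszProjection hp hq hhs heven hφ0 hwx
      (symL_comp_neg (B (rieszProjection p (toLpT p g)) : LpT p)) hYf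
    filter_upwards [hfin, hF0, ae_one_add_ne_zero] with x e1 e2 e3
    have e4 : φ0 x ≠ 0 := mul_ne_zero e3 (inv_ne_zero e2)
    change T (toLpT p g) x = (φ0 x)⁻¹ * symL q (rieszProjection q w) x
    rw [← e1, inv_mul_cancel_left₀ e4]
    rfl

end Necessity

/-! ### Twists of the symbol and the backward shift -/

/-- The symbol `t ^ (-n) φ`. -/
def twist (φ : LpT ∞) (n : ℤ) : LpT ∞ := mulOp ∞ (fourierLp ∞ (-n)) φ

theorem coeFn_twist (φ : LpT ∞) (n : ℤ) : twist φ n =ᵐ[μ𝕋] fun x => fourier (-n) x * φ x := by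
  filter_upwards [coeFn_mulOp (fourierLp ∞ (-n)) φ, coeFn_fourierLp (T := 1) ∞ (-n)] with x e1 e2
  rw [twist, e1, e2]

theorem IsInvertibleLinfty.twist {φ : LpT ∞} (h : IsInvertibleLinfty φ) (n : ℤ) :
    IsInvertibleLinfty (twist φ n) := by
  obtain ⟨ψ, hψ⟩ := h
  refine ⟨mulOp ∞ (fourierLp ∞ n) ψ, ?_⟩
  filter_upwards [hψ, coeFn_twist φ n, coeFn_mulOp (fourierLp ∞ n) ψ,
    coeFn_fourierLp (T := 1) ∞ n] with x e1 e2 e3 e4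
  rw [e2, e3, e4]
  linear_combination e1 + φ x * ψ x * fourier_neg_mul_fourier n x

theorem isAsymmetricFactorization_twist_iff {p q : ℝ≥0∞} [Fact (1 ≤ p)] [Fact (1 ≤ q)] {φ : LpT ∞}
    {φm φ0 : 𝕋 → ℂ} {κ : ℤ} : IsAsymmetricFactorization p q (twist φ κ) φm 0 φ0 ↔
      IsAsymmetricFactorization p q φ φm κ φ0 := by
  constructor <;> rintro ⟨h1, h2, h3, h4, h5, h6⟩ <;> refine ⟨?_, h2, h3, h4, h5, h6⟩
  · filter_upwards [h1, coeFn_twist φ κ] with x e1 e2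
    rw [e2, fourier_zero] at e1
    linear_combination fourier κ x * e1 - φ x * fourier_neg_mul_fourier κ x
  · filter_upwards [h1, coeFn_twist φ κ] with x e1 e2
    rw [e2, e1, fourier_zero]
    linear_combination φm x * φ0 x * fourier_neg_mul_fourier κ x

section Chain

variable {p q : ℝ≥0∞} [Fact (1 ≤ p)] [Fact (1 ≤ q)] [q.HolderConjugate p]

theorem fourierCoeff_mulOp_twist (φ : LpT ∞) (n : ℤ) (F : LpT p) (m : ℤ) :
    fourierCoeff (mulOp p (twist φ n) F) m = fourierCoeff (mulOp p φ F) (m + n) := by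
  have : mulOp p (twist φ n) F =ᵐ[μ𝕋] fun x => fourier (-n) x * mulOp p φ F x := by
    filter_upwards [coeFn_mulOp (twist φ n) F, coeFn_twist φ n, coeFn_mulOp φ F] with x e1 e2 e3
    rw [e1, e2, e3, mul_assoc]
  rw [fourierCoeff_congr this, fourierCoeff_fourier_mul, sub_neg_eq_add]

theorem fourierCoeff_toeplitz_fourierLp (hp : p ≠ ∞) (hq : q ≠ ∞) (k : ℤ) (f : Hp p) {n : ℤ}
    (hn : 0 ≤ n) : fourierCoeff (toeplitz p (fourierLp ∞ k) f : LpT p) n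
      = fourierCoeff (f : LpT p) (n - k) := by
  change fourierCoeff (rieszProjection p (mulOp p (fourierLp ∞ k) (f : LpT p)) : LpT p) n = _
  rw [fourierCoeff_rieszProjection (q := q) hp hq, if_pos hn, fourierCoeff_mulOp_fourierLp]

theorem backwardShift_forwardShift (hp : p ≠ ∞) (hq : q ≠ ∞) (f : Hp p) :
    toeplitz p (fourierLp ∞ (-1)) (toeplitz p (fourierLp ∞ 1) f) = f :=
  Hp_ext fun n hn => by
    rw [fourierCoeff_toeplitz_fourierLp (q := q) hp hq _ _ hn,
      fourierCoeff_toeplitz_fourierLp (q := q) hp hq _ _ (by omega)]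
    congr 1
    ring

theorem finrank_ker_backwardShift (hp : p ≠ ∞) (hq : q ≠ ∞) :
    Module.finrank ℂ (toeplitz p (fourierLp ∞ (-1))).ker = 1 := by
  have hcoef : ∀ n : ℤ, fourierCoeff (rieszProjection p (fourierLp p 0) : LpT p) n
      = if n = 0 then 1 else 0 := fun n => by
    rw [fourierCoeff_rieszProjection (q := q) hp hq, fourierCoeff_fourierLp]
    split_ifs <;> first | rfl | omega
  have hmem : rieszProjection p (fourierLp p 0) ∈ (toeplitz p (fourierLp ∞ (-1))).ker :=
    Hp_ext fun n hn => by
      refine (fourierCoeff_toeplitz_fourierLp (q := q) hp hq _ _ hn).trans ?_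
      rw [hcoef, if_neg (by omega), Submodule.coe_zero, fourierCoeff_zero_Lp]
  refine (finrank_eq_one_iff_of_nonzero' (⟨_, hmem⟩ : (toeplitz p (fourierLp ∞ (-1))).ker)
    fun h => ?_).mpr ?_
  · have h1 := hcoef 0
    rw [show rieszProjection p (fourierLp p 0) = 0 from congrArg Subtype.val h, if_pos rfl,
      Submodule.coe_zero, fourierCoeff_zero_Lp] at h1
    exact zero_ne_one h1
  · rintro ⟨f, hf⟩
    refine ⟨fourierCoeff (f : LpT p) 0, Subtype.ext (Hp_ext fun n hn => ?_)⟩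
    change fourierCoeff (fourierCoeff (f : LpT p) 0 •
      (rieszProjection p (fourierLp p 0) : LpT p) : LpT p) n = fourierCoeff (f : LpT p) n
    rw [fourierCoeff_smul_Lp, hcoef]
    rcases hn.eq_or_lt with rfl | hn
    · rw [if_pos rfl, mul_one]
    · have h1 := fourierCoeff_toeplitz_fourierLp (q := q) hp hq (-1) f (show 0 ≤ n - 1 by omega)
      have h2 : toeplitz p (fourierLp ∞ (-1)) f = 0 := hf
      rw [h2, Submodule.coe_zero, fourierCoeff_zero_Lp, sub_neg_eq_add, sub_add_cancel] at h1
      rw [← h1, if_neg hn.ne', mul_zero]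

theorem toeplitzHankel_twist_succ (hp : p ≠ ∞) (hq : q ≠ ∞) (φ : LpT ∞) (n : ℤ) (f : Hp p) :
    toeplitzHankel p (twist φ (n + 1)) f
      = toeplitz p (fourierLp ∞ (-1)) (toeplitzHankel p (twist φ n) f) :=
  Hp_ext fun m hm => by
    rw [fourierCoeff_toeplitzHankel (q := q) hp hq _ _ hm,
      fourierCoeff_toeplitz_fourierLp (q := q) hp hq _ _ hm,
      fourierCoeff_toeplitzHankel (q := q) hp hq _ _ (by omega), fourierCoeff_mulOp_twist,
      fourierCoeff_mulOp_twist]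
    congr 1
    ring

theorem eq_zero_of_mulOp_symL_eq_zero {φ : LpT ∞} (hφ : IsInvertibleLinfty φ) {f : Hp p}
    (h : mulOp p φ (symL p (f : LpT p)) =ᵐ[μ𝕋] 0) : f = 0 := by
  refine eq_zero_of_symL_eq_zero (Lp.ext ?_)
  filter_upwards [h, coeFn_mulOp φ (symL p (f : LpT p)), hφ.ae_ne_zero, Lp.coeFn_zero ℂ p μ𝕋]
    with x e1 e2 e3 e4
  rw [e4]
  rw [e2] at e1
  exact (mul_eq_zero.mp e1).resolve_left e3

/-- The nonnegative coefficients of `A_n f` are those of `φ (f + J f)` from order `n` on. -/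
theorem eq_zero_of_forall_twist (hp : p ≠ ∞) (hq : q ≠ ∞) {φ : LpT ∞} (hφ : IsInvertibleLinfty φ)
    {f : Hp p} (h : ∀ n, toeplitzHankel p (twist φ n) f = 0) : f = 0 := by
  refine eq_zero_of_mulOp_symL_eq_zero hφ
    (ae_eq_zero_of_fourierCoeff_eq_zero (integrable_Lp _) fun n => ?_)
  rw [← zero_add n, ← fourierCoeff_mulOp_twist,
    ← fourierCoeff_toeplitzHankel (q := q) hp hq _ _ le_rfl, h, Submodule.coe_zero,
    fourierCoeff_zero_Lp]

/-- The analogue of Coburn's lemma: the kernel and the cokernel of `M(φ)` cannot both be nonzero.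
If `h ∈ L^q` represents a functional vanishing on the range, and `G = φ (f + J f)` for `f` in the
kernel, then `h G` is odd, while its spectrum is negative with nonzero leading coefficient. -/
theorem coburn (hp : p ≠ ∞) (hq : q ≠ ∞) {φ : LpT ∞} (hφ : IsInvertibleLinfty φ)
    {f : Hp p} {ℓ : StrongDual ℂ (Hp p)} (hf : f ≠ 0) (hAf : toeplitzHankel p φ f = 0)
    (hℓ : ∀ g, ℓ (toeplitzHankel p φ g) = 0) : ℓ = 0 := by
  by_contra hℓ0
  set F := symL p (f : LpT p) with hF
  set G := mulOp p φ F with hG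
  have hGs : SpecLE G (-1) := fun n hn => by
    rw [hG, hF, ← fourierCoeff_toeplitzHankel (q := q) hp hq φ f (by omega), hAf]
    exact fourierCoeff_zero_Lp p n
  obtain ⟨a, ha, hGa, hGa0⟩ := exists_leading (integrable_Lp G) hGs fun h =>
    hf (eq_zero_of_mulOp_symL_eq_zero hφ h)
  obtain ⟨h, hh⟩ := exists_pairing_eq (q := q) hp hq (ℓ ∘L rieszProjection p)
  have hhX : ∀ X : LpT p, pairing h X = ℓ (rieszProjection p X) := fun X => by rw [hh]; rfl
  have hhs : SpecLE h 0 := fun n hn => by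
    have h0 : rieszProjection p (fourierLp p (-n)) = 0 := Hp_ext fun m hm => by
      rw [fourierCoeff_rieszProjection (q := q) hp hq, if_pos hm, fourierCoeff_fourierLp,
        if_neg (by omega), Submodule.coe_zero, fourierCoeff_zero_Lp]
    rw [← neg_neg n, ← pairing_fourierLp (p := p), hhX, h0, map_zero]
  obtain ⟨b, hb, hhb, hhb0⟩ := exists_leading (integrable_Lp h) hhs fun h0 => by
    refine hℓ0 (ContinuousLinearMap.ext fun g => ?_)
    rw [← rieszProjection_coe (q := q) hp hq g, ← hhX, pairing_apply]
    refine integral_eq_zero_of_ae ?_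
    filter_upwards [h0] with x hx
    rw [hx, Pi.zero_apply, zero_mul]
  have hvsym := comp_neg_of_annihilates hp hq (Lp.memLp (mulOp q φ h)) fun g => by
    have h1 : ∫ x, mulOp q φ h x * symL p g x ∂μ𝕋
        = ∫ x, h x * mulOp p φ (symL p (g : LpT p)) x ∂μ𝕋 := by
      refine integral_congr_ae ?_
      filter_upwards [coeFn_mulOp φ h, coeFn_mulOp φ (symL p (g : LpT p))] with x e1 e2
      rw [e1, e2]
      ring
    rw [h1, ← pairing_apply, hhX, ← toeplitzHankel_apply, hℓ]
  have hkF : ∀ᵐ x ∂μ𝕋, h x * G x = mulOp q φ h x * F x := by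
    filter_upwards [coeFn_mulOp φ h, coeFn_mulOp φ F] with x e1 e2
    rw [hG, e1, e2]
    ring
  have hksym : ∀ᵐ x ∂μ𝕋, h (-x) * G (-x) = -(fourier 0 x * (h x * G x)) := by
    filter_upwards [hkF, ae_comp_neg hkF, hvsym, symL_comp_neg (f : LpT p)] with x e1 e2 e3 e4
    rw [e1, e2, e3, e4, fourier_zero]
    linear_combination -mulOp q φ h x * F x * fourier_neg_mul_fourier 1 x
  have hlead := fourierCoeff_mul_of_specLE hq hp (Lp.memLp h) (Lp.memLp G) hhb hGa (le_refl (b + a))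
  have hhigh := fourierCoeff_mul_of_specLE hq hp (Lp.memLp h) (Lp.memLp G) hhb hGa
    (show b + a ≤ -(b + a) by omega)
  rw [if_pos rfl] at hlead
  rw [if_neg (by omega), fourierCoeff_of_antisymm (k := fun x => h x * G x) hksym, sub_zero, hlead,
    neg_eq_zero] at hhigh
  exact mul_ne_zero hhb0 hGa0 hhigh

theorem isFredholm_iff_exists_bijective (hp : p ≠ ∞) (hq : q ≠ ∞) {φ : LpT ∞}
    (hφ : IsInvertibleLinfty φ) : (toeplitzHankel p (twist φ 0)).IsFredholm ↔
      ∃ κ, Function.Bijective (toeplitzHankel p (twist φ κ)) := by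
  have hker := finrank_ker_backwardShift (q := q) hp hq
  have hLS := backwardShift_forwardShift (q := q) hp hq
  have hA := toeplitzHankel_twist_succ (q := q) hp hq φ
  constructor
  · intro hF
    exact exists_bijective_of_isFredholm (A := fun n => toeplitzHankel p (twist φ n)) hLS hker hA hF
      (fun f h => eq_zero_of_forall_twist (q := q) hp hq hφ h)
      fun n f ℓ hf hAf hℓ => coburn (q := q) hp hq (hφ.twist n) hf hAf hℓ
  · rintro ⟨κ, hκ⟩
    have : FiniteDimensional ℂ (toeplitz p (fourierLp ∞ (-1))).ker :=
      Module.finite_of_finrank_pos (by omega)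
    exact (chain_isFredholm_iff (A := fun n => toeplitzHankel p (twist φ n)) hLS hA κ).mp
      (isFredholm_of_bijective hκ)

theorem twist_zero (φ : LpT ∞) : twist φ 0 = φ := by
  refine Lp.ext ?_
  filter_upwards [coeFn_twist φ 0] with x hx
  rw [hx, neg_zero, fourier_zero, one_mul]

theorem finrank_ker_of_bijective_twist (hp : p ≠ ∞) (hq : q ≠ ∞) {φ : LpT ∞} {κ : ℤ}
    (hκ : Function.Bijective (toeplitzHankel p (twist φ κ))) :
    (FiniteDimensional ℂ (toeplitzHankel p φ).ker ∧
      (Module.finrank ℂ (toeplitzHankel p φ).ker : ℤ) = max 0 (-κ)) ∧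
    (FiniteDimensional ℂ (banachAdjoint (toeplitzHankel p φ)).ker ∧
      (Module.finrank ℂ (banachAdjoint (toeplitzHankel p φ)).ker : ℤ) = max 0 κ) := by
  have hker := finrank_ker_backwardShift (q := q) hp hq
  have hL : Function.Surjective (toeplitz p (fourierLp ∞ (-1))) := fun f =>
    ⟨_, backwardShift_forwardShift (q := q) hp hq f⟩
  have hA := toeplitzHankel_twist_succ (q := q) hp hq φ
  have hrank : ∀ {V : Type} [AddCommGroup V] [Module ℂ V] {k : ℕ}, Module.rank ℂ V = k →
      FiniteDimensional ℂ V ∧ (Module.finrank ℂ V : ℤ) = k := fun h =>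
    ⟨Module.finite_of_rank_eq_nat h, by rw [Module.finrank_eq_of_rank_eq h]⟩
  rw [← twist_zero φ]
  rcases le_total κ 0 with h0 | h0
  · obtain ⟨k, hk⟩ := Int.eq_ofNat_of_zero_le (neg_nonneg.mpr h0)
    obtain rfl : κ = -(k : ℤ) := by rw [← hk, neg_neg]
    obtain ⟨h1, h2⟩ := chain_ker_of_nonpos (A := fun n => toeplitzHankel p (twist φ n)) hL hker hA
      k hκ
    rw [max_eq_right (neg_nonneg.mpr h0), max_eq_left h0, neg_neg, h2]
    exact ⟨hrank h1, inferInstance, by rw [finrank_bot, Nat.cast_zero]⟩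
  · obtain ⟨k, rfl⟩ := Int.eq_ofNat_of_zero_le h0
    obtain ⟨h1, h2⟩ := chain_ker_of_nonneg (A := fun n => toeplitzHankel p (twist φ n)) hL hker hA
      k hκ
    rw [max_eq_left (neg_nonpos.mpr h0), max_eq_right h0, h1]
    exact ⟨⟨inferInstance, by rw [finrank_bot, Nat.cast_zero]⟩, hrank h2⟩

end Chain

end ToeplitzHankel

end

theorem theoremt5p4 (p q : ℝ≥0∞) [Fact (1 ≤ p)] [Fact (1 ≤ q)]
    (hp_one : 1 < p) (hp_top : p < ∞) (hpq : p.HolderConjugate q)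
    (φ : ToeplitzHankel.LpT ∞) (hφ : ToeplitzHankel.IsInvertibleLinfty φ) :
    ((ToeplitzHankel.toeplitzHankel p φ).IsFredholm ↔
      ∃ (φm : ToeplitzHankel.𝕋 → ℂ) (κ : ℤ) (φ0 : ToeplitzHankel.𝕋 → ℂ),
        ToeplitzHankel.IsAsymmetricFactorization p q φ φm κ φ0) ∧
    ∀ (φm : ToeplitzHankel.𝕋 → ℂ) (κ : ℤ) (φ0 : ToeplitzHankel.𝕋 → ℂ),
      ToeplitzHankel.IsAsymmetricFactorization p q φ φm κ φ0 →
        (FiniteDimensional ℂ (ToeplitzHankel.toeplitzHankel p φ).ker ∧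
          (Module.finrank ℂ (ToeplitzHankel.toeplitzHankel p φ).ker : ℤ) = max 0 (-κ)) ∧
        (FiniteDimensional ℂ
            (ToeplitzHankel.banachAdjoint (ToeplitzHankel.toeplitzHankel p φ)).ker ∧
          (Module.finrank ℂ
            (ToeplitzHankel.banachAdjoint (ToeplitzHankel.toeplitzHankel p φ)).ker : ℤ)
              = max 0 κ) := by
  have : p.HolderConjugate q := hpq
  have : q.HolderConjugate p := hpq.symm
  have hp : p ≠ ∞ := hp_top.ne
  have hq : q ≠ ∞ := ((ENNReal.HolderConjugate.lt_top_iff_one_lt q p).mpr hp_one).ne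
  have hbij : ∀ φm κ φ0, ToeplitzHankel.IsAsymmetricFactorization p q φ φm κ φ0 →
      Function.Bijective (ToeplitzHankel.toeplitzHankel p (ToeplitzHankel.twist φ κ)) :=
    fun φm κ φ0 h => ToeplitzHankel.bijective_of_factorization hp hq (hφ.twist κ)
      (ToeplitzHankel.isAsymmetricFactorization_twist_iff.mpr h)
  refine ⟨?_, fun φm κ φ0 h =>
    ToeplitzHankel.finrank_ker_of_bijective_twist (q := q) hp hq (hbij φm κ φ0 h)⟩
  have hfred := ToeplitzHankel.isFredholm_iff_exists_bijective (q := q) hp hq hφ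
  rw [ToeplitzHankel.twist_zero] at hfred
  rw [hfred]
  constructor
  · rintro ⟨κ, hκ⟩
    obtain ⟨φm, φ0, h⟩ := ToeplitzHankel.exists_factorization_of_bijective (q := q) hp hq hκ
    exact ⟨φm, κ, φ0, ToeplitzHankel.isAsymmetricFactorization_twist_iff.mp h⟩
  · rintro ⟨φm, κ, φ0, h⟩
    exact ⟨κ, hbij φm κ φ0 h⟩
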